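/- **Setting.** There are $n\ge 1$ agents and rounds $t=1,2,\dots$. Let $\mathbb X\subset\mathbb R^p$ be closed and convex with $\|x\|\le R$ on $\mathbb X$. For each agent $i$ and each $t$ let $f_{i,t}:\mathbb X\to\mathbb R$ and $g_{i,t}:\mathbb X\to\mathbb R^{m_i}$ be convex (the latter componentwise), with $|f_{i,t}(x)-f_{i,t}(y)|\le F_1$ and $\|g_{i,t}(x)\|\le F_1$ for $x,y\in\mathbb X$, and with subgradients $\partial f_{i,t}(x)$ and subgradient matrices $\partial g_{i,t}(x)$ of norm at most $F_2$ at every $x\in\mathbb X$. Put $f_t=\frac1n\sum_j f_{j,t}$ and $g_t=\mathrm{col}(g_{1,t},\dots,g_{n,t})$, and let $[\cdot]_+$ be the componentwise positive part. The agents communicate over directed graphs $\mathcal G_t=([n],\mathcal E_t)$ with doubly stochastic matrices $W_t$ such that $[W_t]_{ij}>0$ if $(j,i)\in\mathcal E_t$ or $i=j$, and $[W_t]_{ij}=0$ otherwise; the positive entries are at least $w\in(0,1)$, and for some integer $B>0$ the graph $([n],\bigcup_{l=0}^{B-1}\mathcal E_{t+l})$ is strongly connected for every $t\ge1$. **Algorithm.**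 Start from $x_{i,1}\in\mathbb X$, $\hat x_{i,1}=x_{i,1}$, $q_{i,1}=0$. For $t\ge 1$ let $$z_{i,t+1}=\sum_j [W_t]_{ij}\hat x_{j,t},\qquad \omega_{i,t+1}=\partial f_{i,t}(x_{i,t})+\partial[g_{i,t}(x_{i,t})]_+\,q_{i,t},\qquad x_{i,t+1}=\mathcal P_{\mathbb X}(z_{i,t+1}-\alpha_{t+1}\omega_{i,t+1}),$$ $$q_{i,t+1}=\Big[(1-\beta_{t+1}\gamma_{t+1})q_{i,t}+\gamma_{t+1}\big([g_{i,t}(x_{i,t})]_+ +(\partial[g_{i,t}(x_{i,t})]_+)^T(x_{i,t+1}-x_{i,t})\big)\Big]_+,$$ and let $\hat x_{i,t+1}=x_{i,t+1}$ if $\|x_{i,t+1}-\hat x_{i,t}\|\ge\tau_{t+1}$ and $\hat x_{i,t+1}=\hat x_{i,t}$ otherwise. Here $\mathcal P_{\mathbb X}$ is the Euclidean projection onto $\mathbb X$, and $\partial[g_{i,t}(x_{i,t})]_+$ is a matrix whose columns are subgradients on $\mathbb X$ of the components of $[g_{i,t}]_+$ at $x_{i,t}$; the observed subgradients $\partial f_{i,t}(x_{i,t})$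 and $\partial[g_{i,t}(x_{i,t})]_+$ have norm at most $F_2$. The parameters are $$\alpha_t=\frac{\alpha_0}{t^{\theta_1}},\quad \beta_t=\frac1{t^{\theta_2}},\quad \gamma_t=\frac1{t^{1-\theta_2}},\quad \tau_t=\frac{\tau_0}{t^{\theta_3}},\qquad \theta_1,\theta_2\in(0,1),\ \ \alpha_0,\tau_0,\theta_3>0.$$ **Theorem.** (i) There is a constant $C$, depending only on $n,(m_i),R,F_1,F_2,w,B,\theta_1,\theta_2,\theta_3$, such that for all $\alpha_0,\tau_0>0$, all $T\ge1$ and all $y_1,\dots,y_T\in\mathbb X$ with $g_t(y_t)\le 0$ for $t\le T$, with $P_T=\sum_{t=1}^{T-1}\|y_{t+1}-y_t\|$, $$\frac1n\sum_{i=1}^n\sum_{t=1}^T f_t(x_{i,t})-\sum_{t=1}^T f_t(y_t)\le C\Big(\alpha_0T^{1-\theta_1}+T^{\theta_2}+D_T+\frac{T^{\theta_1}(1+P_T)}{\alpha_0}\Big),$$ where $D_T=\frac{\tau_0}{\alpha_0}T^{1+\theta_1-\theta_3}$ if $\theta_1<\theta_3<1+\theta_1$, $D_T=\frac{\tau_0}{\alpha_0}\log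 T$ if $\theta_3=1+\theta_1$, and $D_T=\frac{\tau_0}{\alpha_0}$ if $\theta_3>1+\theta_1$. (ii) For all $a,b>0$ there is a constant $C$, depending only on $a$, $b$ and the quantities listed in (i), such that for all $\alpha_0\ge a$, all $0<\tau_0\le b$ and all $T\ge1$ for which some $v\in\mathbb X$ satisfies $g_t(v)\le 0$ for every $t\le T$, $$\frac1n\sum_{i=1}^n\sum_{t=1}^T\big\|[g_t(x_{i,t})]_+\big\|\le C\Big(\sqrt{\alpha_0}\,T^{1-\theta_1/2}+T^{1-\theta_2/2}+E_T\Big),$$ where $E_T=\sqrt{\tau_0}\,T^{1-\theta_3/2}$ if $\theta_1<\theta_3<1$, $E_T=\sqrt{\tau_0T\log T}$ if $\theta_3=1$, and $E_T=\sqrt{\tau_0}\,T^{1/2}$ if $\theta_3>1$. -/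

import Mathlib

open scoped BigOperators

noncomputable section

namespace EventTriggered

/-- Decision space `ℝ^p` with the Euclidean norm. -/
abbrev Vec (p : ℕ) : Type := EuclideanSpace ℝ (Fin p)

/-- The Euclidean projection `[v]_+` of `v` onto the nonnegative orthant: componentwise
`max (v k) 0`. -/
def orthantProj {ι : Type*} (v : EuclideanSpace ℝ ι) : EuclideanSpace ℝ ι :=
  WithLp.toLp 2 (fun k => max (v k) 0)

/-- `x` is the projection of `v` onto `X`, i.e. a minimizer over `X` of the distance to `v`. -/
def IsProjection {p : ℕ} (X : Set (Vec p)) (v x : Vec p) : Prop :=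
  x ∈ X ∧ ∀ y ∈ X, ‖v - x‖ ≤ ‖v - y‖

/-- `s` is a subgradient at `x` of the real function `φ` on `X`. -/
def IsSubgradient {p : ℕ} (X : Set (Vec p)) (φ : Vec p → ℝ) (x s : Vec p) : Prop :=
  ∀ y ∈ X, φ x + inner ℝ s (y - x) ≤ φ y

/-- `J` is the transpose of a subgradient matrix at `x` of the vector function `φ` on `X`: the
`k`-th row of `J` is a subgradient of the `k`-th component of `φ`. The norm of `J` as a continuous
linear map is the spectral norm of the matrix. -/
def IsSubgradientMap {p r : ℕ} (X : Set (Vec p)) (φ : Vec p → Vec r) (x : Vec p)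
    (J : Vec p →L[ℝ] Vec r) : Prop :=
  ∀ y ∈ X, ∀ k, φ x k + J (y - x) k ≤ φ y k

/-- An online problem with `n` agents: decision set `X`, local losses `f i t` and local constraint
functions `g i t` with `m i` components. Times are `t = 1, 2, …`; the values at `t = 0` and outside
of `X` are never used. -/
structure Problem (n p : ℕ) (m : Fin n → ℕ) where
  X : Set (Vec p)
  f : Fin n → ℕ → Vec p → ℝ
  g : (i : Fin n) → ℕ → Vec p → Vec (m i)

namespace Problem

variable {n p : ℕ} {m : Fin n → ℕ}

/-- Global loss `f_t = (1/n) ∑ j, f_{j,t}`. -/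
def globalLoss (P : Problem n p m) (t : ℕ) (x : Vec p) : ℝ :=
  (1 / (n : ℝ)) * ∑ j, P.f j t x

/-- Global constraint `g_t = col(g_{1,t}, …, g_{n,t})`. -/
def globalConstraint (P : Problem n p m) (t : ℕ) (x : Vec p) :
    EuclideanSpace ℝ ((i : Fin n) × Fin (m i)) :=
  WithLp.toLp 2 (fun k => P.g k.1 t x k.2)

/-- `(y_1, …, y_T)` is a feasible decision sequence. -/
def Feasible (P : Problem n p m) (T : ℕ) (y : ℕ → Vec p) : Prop :=
  ∀ t ∈ Finset.Icc 1 T, y t ∈ P.X ∧ ∀ k, P.globalConstraint t (y t) k ≤ 0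

/-- Convexity, boundedness and subgradient assumptions on the decision set, the losses and the
constraint functions. -/
structure Regular (P : Problem n p m) (R F₁ F₂ : ℝ) : Prop where
  convex_set : Convex ℝ P.X
  closed_set : IsClosed P.X
  norm_le : ∀ x ∈ P.X, ‖x‖ ≤ R
  convex_loss : ∀ i t, 1 ≤ t → ConvexOn ℝ P.X (P.f i t)
  convex_constraint : ∀ i t, 1 ≤ t → ∀ k, ConvexOn ℝ P.X (fun x => P.g i t x k)
  loss_bound : ∀ i t, 1 ≤ t → ∀ x ∈ P.X, ∀ y ∈ P.X, |P.f i t x - P.f i t y| ≤ F₁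
  constraint_bound : ∀ i t, 1 ≤ t → ∀ x ∈ P.X, ‖P.g i t x‖ ≤ F₁
  loss_subgradient : ∀ i t, 1 ≤ t → ∀ x ∈ P.X,
    ∃ s, IsSubgradient P.X (P.f i t) x s ∧ ‖s‖ ≤ F₂
  constraint_subgradient : ∀ i t, 1 ≤ t → ∀ x ∈ P.X,
    ∃ J, IsSubgradientMap P.X (P.g i t) x J ∧ ‖J‖ ≤ F₂

/-- Network regret of the decisions `x i t` against the benchmark `y` over `T` rounds. -/
def netRegret (P : Problem n p m) (x : Fin n → ℕ → Vec p) (T : ℕ) (y : ℕ → Vec p) : ℝ :=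
  (1 / (n : ℝ)) * (∑ i, ∑ t ∈ Finset.Icc 1 T, P.globalLoss t (x i t))
    - ∑ t ∈ Finset.Icc 1 T, P.globalLoss t (y t)

/-- Network cumulative constraint violation of the decisions `x i t` over `T` rounds. -/
def netCCV (P : Problem n p m) (x : Fin n → ℕ → Vec p) (T : ℕ) : ℝ :=
  (1 / (n : ℝ)) * ∑ i, ∑ t ∈ Finset.Icc 1 T, ‖orthantProj (P.globalConstraint t (x i t))‖

end Problem

/-- Path length `∑_{t=1}^{T-1} ‖y_{t+1} - y_t‖`. -/
def pathLength {p : ℕ} (y : ℕ → Vec p) (T : ℕ) : ℝ :=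
  ∑ t ∈ Finset.Ico 1 T, ‖y (t + 1) - y t‖

/-- A time-varying directed graph on the agents with mixing matrices. `(graph t).Adj j i` means
that agent `i` can receive information from agent `j` at time `t`. -/
structure Network (n : ℕ) where
  graph : ℕ → Digraph (Fin n)
  W : ℕ → Matrix (Fin n) (Fin n) ℝ

/-- The mixing matrices are supported on the graph and the diagonal, are doubly stochastic with
positive entries at least `w`, and any `B` consecutive graphs have a strongly connected union. -/
structure Network.Regular {n : ℕ} (N : Network n) (w : ℝ) (B : ℕ) : Prop where
  pos : ∀ t, 1 ≤ t → ∀ i j, ((N.graph t).Adj j i ∨ i = j) → 0 < N.W t i j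
  zero : ∀ t, 1 ≤ t → ∀ i j, ¬ ((N.graph t).Adj j i ∨ i = j) → N.W t i j = 0
  lower : ∀ t, 1 ≤ t → ∀ i j, 0 < N.W t i j → w ≤ N.W t i j
  col_sum : ∀ t, 1 ≤ t → ∀ j, ∑ i, N.W t i j = 1
  row_sum : ∀ t, 1 ≤ t → ∀ i, ∑ j, N.W t i j = 1
  connected : ∀ t, 1 ≤ t → ∀ i j,
    Relation.ReflTransGen (fun a b => ∃ l < B, (N.graph (t + l)).Adj a b) i j

/-- Step sizes `α`, `β`, regularization `γ` and event-triggering threshold `τ`. -/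
structure Params where
  α : ℕ → ℝ
  β : ℕ → ℝ
  γ : ℕ → ℝ
  τ : ℕ → ℝ

/-- `α_t = α₀ / t^θ₁`, `β_t = 1 / t^θ₂`, `γ_t = 1 / t^(1-θ₂)`, `τ_t = τ₀ / t^θ₃`. -/
def powerParams (α₀ τ₀ θ₁ θ₂ θ₃ : ℝ) : Params where
  α t := α₀ / (t : ℝ) ^ θ₁
  β t := 1 / (t : ℝ) ^ θ₂
  γ t := 1 / (t : ℝ) ^ (1 - θ₂)
  τ t := τ₀ / (t : ℝ) ^ θ₃

/-- All the variables of the algorithm: decisions `x`, last broadcast decisions `xhat`, consensus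
variables `z`, update directions `ω`, dual variables `q`, observed subgradients `df` of the losses
and observed (transposed) subgradient matrices `dgp` of the clipped constraints `[g]_+`. -/
structure Trajectory (n p : ℕ) (m : Fin n → ℕ) where
  x : Fin n → ℕ → Vec p
  xhat : Fin n → ℕ → Vec p
  z : Fin n → ℕ → Vec p
  ω : Fin n → ℕ → Vec p
  q : (i : Fin n) → ℕ → Vec (m i)
  df : Fin n → ℕ → Vec p
  dgp : (i : Fin n) → ℕ → (Vec p →L[ℝ] Vec (m i))

/-- The trajectory is generated by the distributed event-triggered online primal-dual algorithm,
with observed subgradients bounded by `F₂`. If `J` is a (transposed) subgradient matrix of `g` at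
`x` with `‖J‖ ≤ F₂`, then `dgp` can be `J` with the rows of the nonpositive components of `g x`
replaced by zero. -/
structure Trajectory.IsGenerated {n p : ℕ} {m : Fin n → ℕ} (S : Trajectory n p m)
    (P : Problem n p m) (N : Network n) (c : Params) (F₂ : ℝ) : Prop where
  x_init : ∀ i, S.x i 1 ∈ P.X
  xhat_init : ∀ i, S.xhat i 1 = S.x i 1
  q_init : ∀ i, S.q i 1 = 0
  df_subgradient : ∀ i t, 1 ≤ t → IsSubgradient P.X (P.f i t) (S.x i t) (S.df i t)
  df_bound : ∀ i t, 1 ≤ t → ‖S.df i t‖ ≤ F₂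
  dgp_subgradient : ∀ i t, 1 ≤ t →
    IsSubgradientMap P.X (fun x => orthantProj (P.g i t x)) (S.x i t) (S.dgp i t)
  dgp_bound : ∀ i t, 1 ≤ t → ‖S.dgp i t‖ ≤ F₂
  z_step : ∀ i t, 1 ≤ t → S.z i (t + 1) = ∑ j, N.W t i j • S.xhat j t
  ω_step : ∀ i t, 1 ≤ t →
    S.ω i (t + 1) = S.df i t + ContinuousLinearMap.adjoint (S.dgp i t) (S.q i t)
  x_step : ∀ i t, 1 ≤ t →
    IsProjection P.X (S.z i (t + 1) - c.α (t + 1) • S.ω i (t + 1)) (S.x i (t + 1))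
  q_step : ∀ i t, 1 ≤ t →
    S.q i (t + 1) = orthantProj ((1 - c.β (t + 1) * c.γ (t + 1)) • S.q i t
      + c.γ (t + 1) • (orthantProj (P.g i t (S.x i t)) + S.dgp i t (S.x i (t + 1) - S.x i t)))
  xhat_trigger : ∀ i t, 1 ≤ t → c.τ (t + 1) ≤ ‖S.x i (t + 1) - S.xhat i t‖ →
    S.xhat i (t + 1) = S.x i (t + 1)
  xhat_keep : ∀ i t, 1 ≤ t → ‖S.x i (t + 1) - S.xhat i t‖ < c.τ (t + 1) →
    S.xhat i (t + 1) = S.xhat i t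

end EventTriggered

end

noncomputable section

namespace EventTriggered

/-! Compare the run with a feasible sequence and with dual multipliers whose components all equal
some `s ≥ 0`. The projection inequality for the decisions and the distance recursion for the dual
variables contain the pairing of `dualDrift` with `q - μ` with opposite signs. Adding them
(`agent_step`) cancels it and leaves the loss differences plus `s` times the ℓ¹ violation, bounded
by telescoping distances, movement terms and step-size sums. The dual part telescopes because `β_t
γ_t = 1/t`, and its second-order term stays bounded because `‖q_t‖ = O(t^θ₂)`.

Summed over agents, doubly stochastic averaging does not increase squared distances to the
comparator, so delayed broadcasting only costs a multiple of `triggerError`. Disagreement is handled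
by viewing the broadcast decisions as a perturbed averaging process. Over `n * B` rounds the
transition matrix has all entries at least `w ^ (n * B)` (`transition_ge`) and hence contracts the
diameter (`spread_mix_le`), so the summed disagreement is at most a multiple of the summed
perturbations (`sum_spread_le`), which are trigger errors and consensus steps. Consensus steps enter
linearly, but the projection inequality supplies their squares with a negative sign; completing the
square leaves a term of order `α₀ T^(1-θ₁)`. The outcome is `exists_combined_bound`, valid for every
`s ≥ 0`.

For the regret take `s = 0`. For the violation, loss differences are at least `-n F₁ T` in total,
which gives `s * CCV ≤ C (T + s² A)` for all `s`, and `s = √(T / A)` balances the two terms.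
Uniformity in `α₀` and `τ₀` comes from capping each trigger error both by the threshold and by the
diameter `2R`, and, for the violation, from a trivial linear bound when `α₀ ≥ T^θ₁`. -/

/-! ### Sums of powers and weighted telescoping. -/

/-- Bernoulli's inequality for the concave power `1 - s`, applied at `1 - 1/x`; it makes the power
sums below telescope, replacing a comparison with an integral. -/
theorem one_sub_mul_rpow_neg_le {s x : ℝ} (hs₀ : 0 ≤ s) (hs₁ : s < 1) (hx : 1 ≤ x) :
    (1 - s) * x ^ (-s) ≤ x ^ (1 - s) - (x - 1) ^ (1 - s) := by
  have hx0 : 0 < x := by linarith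
  have hinv : x⁻¹ ≤ 1 := inv_le_one_of_one_le₀ hx
  have hb := rpow_one_add_le_one_add_mul_self (s := -x⁻¹) (p := 1 - s) (by linarith)
    (by linarith) (by linarith)
  have h1 : x - 1 = x * (1 + -x⁻¹) := by field_simp; ring
  have h2 : x ^ (-s) = x ^ (1 - s) * x⁻¹ := by
    rw [← Real.rpow_neg_one x, ← Real.rpow_add hx0]; congr 1; ring
  rw [h1, Real.mul_rpow hx0.le (by linarith), h2]
  have h3 := mul_le_mul_of_nonneg_left hb (Real.rpow_nonneg hx0.le (1 - s))
  linarith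

theorem sum_Icc_one_rpow_neg_le {s : ℝ} (hs₀ : 0 ≤ s) (hs₁ : s < 1) (T : ℕ) :
    ∑ t ∈ Finset.Icc 1 T, (t : ℝ) ^ (-s) ≤ (T : ℝ) ^ (1 - s) / (1 - s) := by
  have hs : 0 < 1 - s := by linarith
  induction T with
  | zero => simp [Real.zero_rpow hs.ne']
  | succ T ih =>
    rw [Finset.sum_Icc_succ_top (by omega)]
    have h := one_sub_mul_rpow_neg_le hs₀ hs₁ (x := ((T + 1 : ℕ) : ℝ)) (by simp)
    rw [le_div_iff₀ hs] at ih ⊢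
    have h2 : ((T + 1 : ℕ) : ℝ) - 1 = T := by simp
    rw [h2] at h
    linarith

theorem sum_Icc_two_rpow_neg_le {s : ℝ} (hs₀ : 0 ≤ s) (hs₁ : s < 1) (T : ℕ) :
    ∑ t ∈ Finset.Icc 2 T, (t : ℝ) ^ (-s) ≤ (T : ℝ) ^ (1 - s) / (1 - s) :=
  (Finset.sum_le_sum_of_subset_of_nonneg (Finset.Icc_subset_Icc_left (by norm_num))
    fun _ _ _ => Real.rpow_nonneg (Nat.cast_nonneg _) _).trans
    (sum_Icc_one_rpow_neg_le hs₀ hs₁ T)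

theorem sum_Icc_two_rpow_neg_one_le_log {T : ℕ} (hT : 1 ≤ T) :
    ∑ t ∈ Finset.Icc 2 T, (t : ℝ) ^ (-1 : ℝ) ≤ Real.log T := by
  induction T, hT using Nat.le_induction with
  | base => simp
  | succ T hT ih =>
    rw [Finset.sum_Icc_succ_top (by omega)]
    have hT0 : (0 : ℝ) < T := by exact_mod_cast hT
    have h1 : (0 : ℝ) < ((T + 1 : ℕ) : ℝ) := by positivity
    have h := Real.one_sub_inv_le_log_of_pos (x := ((T + 1 : ℕ) : ℝ) / T) (by positivity)
    rw [Real.log_div h1.ne' hT0.ne', inv_div] at h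
    have h2 : (1 : ℝ) - T / ((T + 1 : ℕ) : ℝ) = ((T + 1 : ℕ) : ℝ) ^ (-1 : ℝ) := by
      rw [Real.rpow_neg_one]; field_simp; push_cast; ring
    rw [h2] at h
    linarith

/-- The three regimes of `∑_{t=2}^T t^(-s)` with a common constant. -/
theorem exists_sum_Icc_two_rpow_neg_le (s : ℝ) : ∃ C : ℝ, 0 ≤ C ∧ ∀ T : ℕ, 1 ≤ T →
    (0 < s → s < 1 → ∑ t ∈ Finset.Icc 2 T, (t : ℝ) ^ (-s) ≤ C * (T : ℝ) ^ (1 - s)) ∧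
    (s = 1 → ∑ t ∈ Finset.Icc 2 T, (t : ℝ) ^ (-s) ≤ C * Real.log T) ∧
    (1 < s → ∑ t ∈ Finset.Icc 2 T, (t : ℝ) ^ (-s) ≤ C) := by
  rcases lt_trichotomy s 1 with h | h | h
  · refine ⟨(1 - s)⁻¹, by rw [inv_nonneg]; linarith, fun T _ => ⟨fun h0 h1 => ?_, ?_, ?_⟩⟩
    · rw [inv_mul_eq_div]; exact sum_Icc_two_rpow_neg_le h0.le h1 T
    · intro h'; linarith
    · intro h'; linarith
  · refine ⟨1, zero_le_one, fun T hT => ⟨fun _ h1 => ?_, fun _ => ?_, fun h' => ?_⟩⟩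
    · linarith
    · rw [h, one_mul]; exact sum_Icc_two_rpow_neg_one_le_log hT
    · linarith
  · have hnn : ∀ t : ℕ, 0 ≤ (t : ℝ) ^ (-s) := fun t => Real.rpow_nonneg (Nat.cast_nonneg _) _
    refine ⟨∑' t : ℕ, (t : ℝ) ^ (-s), tsum_nonneg hnn,
      fun T _ => ⟨fun _ h1 => ?_, fun h' => ?_, fun _ => ?_⟩⟩
    · linarith
    · linarith
    · exact (Real.summable_nat_rpow.2 (by linarith)).sum_le_tsum _ fun t _ => hnn t

theorem rpow_succ_le_two_mul {θ : ℝ} (h₀ : 0 ≤ θ) (h₁ : θ ≤ 1) {t : ℕ} (ht : 1 ≤ t) :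
    ((t + 1 : ℕ) : ℝ) ^ θ ≤ 2 * (t : ℝ) ^ θ := by
  have ht' : (1 : ℝ) ≤ t := by exact_mod_cast ht
  calc ((t + 1 : ℕ) : ℝ) ^ θ ≤ (2 * (t : ℝ)) ^ θ :=
        Real.rpow_le_rpow (by positivity) (by push_cast; linarith) h₀
    _ = 2 ^ θ * (t : ℝ) ^ θ := Real.mul_rpow (by norm_num) (by positivity)
    _ ≤ 2 * (t : ℝ) ^ θ := by
        gcongr
        calc (2 : ℝ) ^ θ ≤ 2 ^ (1 : ℝ) := Real.rpow_le_rpow_of_exponent_le (by norm_num) h₁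
          _ = 2 := Real.rpow_one 2

theorem sum_Icc_rpow_neg_succ_le {s : ℝ} (hs₀ : 0 ≤ s) (hs₁ : s < 1) (T : ℕ) :
    ∑ t ∈ Finset.Icc 1 T, 1 / ((t + 1 : ℕ) : ℝ) ^ s ≤ (T : ℝ) ^ (1 - s) / (1 - s) := by
  refine (Finset.sum_le_sum fun t ht => ?_).trans (sum_Icc_one_rpow_neg_le hs₀ hs₁ T)
  have ht' : (0 : ℝ) < t := by exact_mod_cast (Finset.mem_Icc.1 ht).1
  rw [Real.rpow_neg ht'.le, one_div]
  apply inv_anti₀ (by positivity)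
  exact Real.rpow_le_rpow ht'.le (by push_cast; linarith) hs₀

/-- Telescoping of weighted differences of squared distances to a moving comparator. -/
theorem sum_mul_sub_le_of_monotone {a u v d : ℕ → ℝ} {M : ℝ}
    (ha₀ : ∀ t, 1 ≤ t → 0 ≤ a t) (ha : ∀ t, 1 ≤ t → a t ≤ a (t + 1)) {T : ℕ} (hT : 1 ≤ T)
    (hu : ∀ t ∈ Finset.Icc 1 T, u t ≤ M)
    (hv : ∀ t ∈ Finset.Icc 1 T, v t ≤ M)
    (hd : ∀ t ∈ Finset.Ico 1 T, u (t + 1) ≤ v t + d t) :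
    ∑ t ∈ Finset.Icc 1 T, a t * (u t - v t) ≤
      a T * (M + ∑ t ∈ Finset.Ico 1 T, |d t|) - a T * v T := by
  induction T, hT using Nat.le_induction with
  | base =>
    have := mul_le_mul_of_nonneg_left (hu 1 (by simp)) (ha₀ 1 le_rfl)
    simp; linarith
  | succ T hT ih =>
    have ih' := ih (fun t ht => hu t (Finset.Icc_subset_Icc_right (by omega) ht))
      (fun t ht => hv t (Finset.Icc_subset_Icc_right (by omega) ht))
      (fun t ht => hd t (Finset.Ico_subset_Ico_right (by omega) ht))
    rw [Finset.sum_Icc_succ_top (by omega), Finset.sum_Ico_succ_top hT]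
    have h1 := hd T (by simp; omega)
    have h2 := hv T (by simp; omega)
    have h3 := ha T hT
    have h4 := ha₀ T hT
    have h5 := ha₀ (T + 1) (by omega)
    have h6 : 0 ≤ ∑ t ∈ Finset.Ico 1 T, |d t| := Finset.sum_nonneg fun _ _ => abs_nonneg _
    have h7 := le_abs_self (d T)
    have h8 := mul_le_mul_of_nonneg_left (h1.trans (add_le_add_right h7 (v T))) h5
    -- The retained term `- a T * v T` pays here: raising the weight from `a T` to `a (T + 1)` costs
    -- `(a (T + 1) - a T) * v T`, at most the same increment times `M`.
    have h9 := mul_nonneg (sub_nonneg.2 h3) (sub_nonneg.2 h2)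
    have h10 := mul_nonneg (sub_nonneg.2 h3) h6
    nlinarith

/-! ### Diameter of a family of vectors and its contraction under averaging. -/

section Spread

variable {n : ℕ} {E : Type*} [NormedAddCommGroup E]

/-- The largest distance between two of the vectors `u i`. -/
def spread (u : Fin n → E) : ℝ := Metric.diam (Set.range u)

theorem spread_nonneg (u : Fin n → E) : 0 ≤ spread u := Metric.diam_nonneg

theorem norm_sub_le_spread (u : Fin n → E) (i j : Fin n) : ‖u i - u j‖ ≤ spread u := by
  rw [← dist_eq_norm]
  exact Metric.dist_le_diam_of_mem (Set.finite_range u).isBounded ⟨i, rfl⟩ ⟨j, rfl⟩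

theorem spread_le {u : Fin n → E} {d : ℝ} (hd : 0 ≤ d) (h : ∀ i j, ‖u i - u j‖ ≤ d) :
    spread u ≤ d := by
  refine Metric.diam_le_of_forall_dist_le hd ?_
  rintro _ ⟨i, rfl⟩ _ ⟨j, rfl⟩
  rw [dist_eq_norm]
  exact h i j

theorem spread_add_le (u v : Fin n → E) : spread (u + v) ≤ spread u + spread v := by
  refine spread_le (add_nonneg (spread_nonneg u) (spread_nonneg v)) fun i j => ?_
  have h : (u + v) i - (u + v) j = (u i - u j) + (v i - v j) := by
    simp only [Pi.add_apply]; abel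
  rw [h]
  exact (norm_add_le _ _).trans (add_le_add (norm_sub_le_spread u i j) (norm_sub_le_spread v i j))

theorem spread_le_two_mul_sum_norm (u : Fin n → E) : spread u ≤ 2 * ∑ i, ‖u i‖ := by
  have h : ∀ i, ‖u i‖ ≤ ∑ i, ‖u i‖ := fun i =>
    Finset.single_le_sum (f := fun i => ‖u i‖) (fun _ _ => norm_nonneg _) (Finset.mem_univ i)
  have h0 : 0 ≤ ∑ i, ‖u i‖ := Finset.sum_nonneg fun _ _ => norm_nonneg _
  refine spread_le (by linarith) fun i j => ?_
  have := norm_sub_le (u i) (u j)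
  linarith [h i, h j]

variable [NormedSpace ℝ E]

/-- The weighted averages `∑ j, A i j • u j`. -/
def mix (A : Matrix (Fin n) (Fin n) ℝ) (u : Fin n → E) : Fin n → E :=
  fun i => ∑ j, A i j • u j

theorem mix_one (u : Fin n → E) : mix (1 : Matrix (Fin n) (Fin n) ℝ) u = u := by
  ext i; simp [mix, Matrix.one_apply]

theorem mix_mul (A A' : Matrix (Fin n) (Fin n) ℝ) (u : Fin n → E) :
    mix (A * A') u = mix A (mix A' u) := by
  ext i
  simp only [mix, Matrix.mul_apply, Finset.sum_smul, Finset.smul_sum, smul_smul]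
  rw [Finset.sum_comm]

theorem mix_sub (A : Matrix (Fin n) (Fin n) ℝ) (u v : Fin n → E) :
    mix A (u - v) = mix A u - mix A v := by
  ext i; simp [mix, smul_sub]

/-- Dobrushin contraction: the common part `η` of all entries contributes the same vector to every
average, so only the residual mass `1 - n * η` of each row can separate two of them. -/
theorem spread_mix_le {A : Matrix (Fin n) (Fin n) ℝ} {η : ℝ} (hη : ∀ i j, η ≤ A i j)
    (hrow : ∀ i, ∑ j, A i j = 1) (u : Fin n → E) :
    spread (mix A u) ≤ (1 - n * η) * spread u := by
  rcases Nat.eq_zero_or_pos n with rfl | hn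
  · have h0 : ∀ v : Fin 0 → E, spread v = 0 := fun v =>
      le_antisymm (spread_le le_rfl fun i => i.elim0) (spread_nonneg v)
    simp [h0]
  set c : ℝ := 1 - n * η with hc
  have hsum : ∀ i, ∑ j, (A i j - η) = c := fun i => by
    simp [Finset.sum_sub_distrib, hrow, hc]
  have hc0 : 0 ≤ c := by
    rw [← hsum ⟨0, hn⟩]
    exact Finset.sum_nonneg fun j _ => sub_nonneg.2 (hη _ j)
  have hmix : ∀ i, mix A u i = ∑ k, (A i k - η) • u k + η • ∑ k, u k := fun i => by
    simp [mix, sub_smul, Finset.sum_sub_distrib, Finset.smul_sum]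
  refine spread_le (mul_nonneg hc0 (spread_nonneg u)) fun i j => ?_
  rw [hmix i, hmix j, add_sub_add_right_eq_sub]
  -- Coupling of two residual rows by their product: both have mass `c`, so the pair weights total
  -- `c ^ 2`. The extra factor `c` is cancelled at the end, which is why `c = 0` is treated apart;
  -- there every residual weight vanishes.
  have key : c • (∑ k, (A i k - η) • u k - ∑ k, (A j k - η) • u k) =
      ∑ k, ∑ l, ((A i k - η) * (A j l - η)) • (u k - u l) := by
    simp only [smul_sub, Finset.sum_sub_distrib]
    congr 1
    · rw [Finset.smul_sum]
      refine Finset.sum_congr rfl fun k _ => ?_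
      rw [← Finset.sum_smul, ← Finset.mul_sum, hsum j, smul_smul, mul_comm]
    · rw [Finset.sum_comm, Finset.smul_sum]
      refine Finset.sum_congr rfl fun k _ => ?_
      rw [← Finset.sum_smul, ← Finset.sum_mul, hsum i, smul_smul]
  rcases hc0.eq_or_lt with h0 | hpos
  · have hz : ∀ i k, A i k - η = 0 := fun i k =>
      (Finset.sum_eq_zero_iff_of_nonneg fun j _ => sub_nonneg.2 (hη i j)).1
        ((hsum i).trans h0.symm) k (Finset.mem_univ k)
    simp [hz, ← h0]
  · have hle : ‖c • (∑ k, (A i k - η) • u k - ∑ k, (A j k - η) • u k)‖ ≤ c * (c * spread u) := by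
      rw [key]
      calc ‖∑ k, ∑ l, ((A i k - η) * (A j l - η)) • (u k - u l)‖
          ≤ ∑ k, ∑ l, ((A i k - η) * (A j l - η)) * spread u := by
            refine norm_sum_le_of_le _ fun k _ => norm_sum_le_of_le _ fun l _ => ?_
            have hnn := mul_nonneg (sub_nonneg.2 (hη i k)) (sub_nonneg.2 (hη j l))
            rw [norm_smul, Real.norm_of_nonneg hnn]
            exact mul_le_mul_of_nonneg_left (norm_sub_le_spread u k l) hnn
        _ = c * (c * spread u) := by
            simp only [← Finset.sum_mul, ← Finset.mul_sum, hsum]; ring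
    rw [norm_smul, Real.norm_of_nonneg hc0] at hle
    exact le_of_mul_le_mul_left hle hpos

theorem norm_sub_mix_le {A : Matrix (Fin n) (Fin n) ℝ} (hA : ∀ i j, 0 ≤ A i j)
    (hrow : ∀ i, ∑ j, A i j = 1) (u : Fin n → E) (i : Fin n) :
    ‖u i - mix A u i‖ ≤ spread u := by
  have h : u i - mix A u i = ∑ j, A i j • (u i - u j) := by
    simp [mix, smul_sub, Finset.sum_sub_distrib, ← Finset.sum_smul, hrow]
  rw [h]
  calc ‖∑ j, A i j • (u i - u j)‖ ≤ ∑ j, A i j * spread u := by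
        refine norm_sum_le_of_le _ fun j _ => ?_
        rw [norm_smul, Real.norm_of_nonneg (hA i j)]
        exact mul_le_mul_of_nonneg_left (norm_sub_le_spread u i j) (hA i j)
    _ = spread u := by rw [← Finset.sum_mul, hrow, one_mul]

end Spread

/-! ### Mixing over time-varying graphs. -/

namespace Network

variable {n : ℕ} {N : Network n} {w : ℝ} {B : ℕ}

theorem Regular.nonneg (hN : N.Regular w B) {t : ℕ} (ht : 1 ≤ t) (i j : Fin n) :
    0 ≤ N.W t i j := by
  by_cases h : (N.graph t).Adj j i ∨ i = j
  · exact (hN.pos t ht i j h).le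
  · exact (hN.zero t ht i j h).ge

/-- The transition matrix `W_{t+l-1} ⋯ W_t`. -/
def transition (N : Network n) (t : ℕ) : ℕ → Matrix (Fin n) (Fin n) ℝ
  | 0 => 1
  | l + 1 => N.W (t + l) * N.transition t l

theorem Regular.transition_nonneg (hN : N.Regular w B) {t : ℕ} (ht : 1 ≤ t) (l : ℕ)
    (i j : Fin n) : 0 ≤ N.transition t l i j := by
  induction l generalizing i with
  | zero => simp only [transition, Matrix.one_apply]; split_ifs <;> norm_num
  | succ l ih =>
    rw [transition, Matrix.mul_apply]
    exact Finset.sum_nonneg fun k _ => mul_nonneg (hN.nonneg (by omega) i k) (ih k)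

theorem Regular.transition_row_sum (hN : N.Regular w B) {t : ℕ} (ht : 1 ≤ t) (l : ℕ)
    (i : Fin n) : ∑ j, N.transition t l i j = 1 := by
  induction l generalizing i with
  | zero => simp [transition, Matrix.one_apply]
  | succ l ih =>
    simp only [transition, Matrix.mul_apply]
    rw [Finset.sum_comm]
    simp only [← Finset.mul_sum, ih, mul_one]
    exact hN.row_sum _ (by omega) i

theorem Regular.transition_succ_of_edge (hN : N.Regular w B) (hw : 0 ≤ w) {t : ℕ} (ht : 1 ≤ t)
    {l : ℕ} {i k j : Fin n} (hik : (N.graph (t + l)).Adj k i ∨ i = k)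
    (hk : w ^ l ≤ N.transition t l k j) : w ^ (l + 1) ≤ N.transition t (l + 1) i j := by
  rw [transition, Matrix.mul_apply, pow_succ']
  have h1 : w ≤ N.W (t + l) i k := hN.lower _ (by omega) _ _ (hN.pos _ (by omega) _ _ hik)
  refine (mul_le_mul h1 hk (pow_nonneg hw l) (hw.trans h1)).trans ?_
  exact Finset.single_le_sum (f := fun k => N.W (t + l) i k * N.transition t l k j)
    (fun k _ => mul_nonneg (hN.nonneg (by omega) i k) (hN.transition_nonneg ht l k j))
    (Finset.mem_univ k)

theorem Regular.transition_mono (hN : N.Regular w B) (hw : 0 ≤ w) {t : ℕ} (ht : 1 ≤ t)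
    {l : ℕ} {i j : Fin n} (h : w ^ l ≤ N.transition t l i j) {l' : ℕ} (hl : l ≤ l') :
    w ^ l' ≤ N.transition t l' i j := by
  induction l', hl using Nat.le_induction with
  | base => exact h
  | succ l' _ ih => exact hN.transition_succ_of_edge hw ht (Or.inr rfl) ih

/-- Every set that is not everything is left by an edge of any window of length `B`. -/
theorem Regular.exists_edge_leaving (hN : N.Regular w B) {t : ℕ} (ht : 1 ≤ t)
    {s : Finset (Fin n)} {j : Fin n} (hj : j ∈ s) (hs : s ≠ Finset.univ) :
    ∃ l < B, ∃ a ∈ s, ∃ b ∉ s, (N.graph (t + l)).Adj a b := by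
  by_contra! hcon
  refine hs (Finset.eq_univ_iff_forall.2 fun i => ?_)
  have h := hN.connected t ht j i
  induction h with
  | refl => exact hj
  | tail _ hbc ih =>
    obtain ⟨l, hl, hadj⟩ := hbc
    by_contra hc
    exact hcon l hl _ ih _ hc hadj

/-- The agents that `j` has reached with weight at least `w ^ (k * B)` never drop out, since
diagonal entries are at least `w`. While they are not all agents, joint connectivity adds a new one
in every window of length `B`. -/
theorem Regular.le_card_transition (hN : N.Regular w B) (hw : 0 ≤ w) {t : ℕ} (ht : 1 ≤ t)
    (j : Fin n) (k : ℕ) : min n (k + 1) ≤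
      (Finset.univ.filter fun i => w ^ (k * B) ≤ N.transition t (k * B) i j).card := by
  induction k with
  | zero =>
    refine (min_le_right _ _).trans (Finset.card_pos.2 ⟨j, ?_⟩)
    simp [transition]
  | succ k ih =>
    set s := Finset.univ.filter fun i => w ^ (k * B) ≤ N.transition t (k * B) i j with hs
    set s' := Finset.univ.filter fun i => w ^ ((k + 1) * B) ≤ N.transition t ((k + 1) * B) i j
      with hs'
    have hsub : s ⊆ s' := fun i hi => by
      rw [hs, Finset.mem_filter] at hi
      rw [hs', Finset.mem_filter]
      exact ⟨Finset.mem_univ i, hN.transition_mono hw ht hi.2 (by rw [add_mul]; omega)⟩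
    by_cases huniv : s = Finset.univ
    · refine (min_le_left _ _).trans ?_
      calc n = s.card := by rw [huniv]; simp
        _ ≤ s'.card := Finset.card_le_card hsub
    · have hj : j ∈ s := by
        rw [hs, Finset.mem_filter]
        refine ⟨Finset.mem_univ j, hN.transition_mono hw ht (l := 0) ?_ (Nat.zero_le _)⟩
        simp [transition]
      obtain ⟨l, hl, a, ha, b, hb, hadj⟩ :=
        hN.exists_edge_leaving (t := t + k * B) (by omega) hj huniv
      have ha' := (Finset.mem_filter.1 ha).2
      have hb' : b ∈ s' := by
        rw [hs', Finset.mem_filter]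
        refine ⟨Finset.mem_univ b, ?_⟩
        -- The weight waits at `a` until the edge appears, crosses it in one step, and then waits at
        -- `b` until the window ends; `l < B` leaves room for the crossing.
        have h1 := hN.transition_mono hw ht ha' (l' := k * B + l) (by omega)
        have h2 := hN.transition_succ_of_edge hw ht (i := b) (k := a) (j := j) (l := k * B + l)
          (Or.inl (by rw [← add_assoc]; exact hadj)) h1
        exact hN.transition_mono hw ht h2 (by rw [add_mul]; omega)
      have hlt : s.card < s'.card :=
        Finset.card_lt_card ⟨hsub, fun h => hb (h hb')⟩
      have : min n (k + 1 + 1) ≤ min n (k + 1) + 1 := by omega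
      omega

theorem Regular.transition_ge (hN : N.Regular w B) (hw : 0 ≤ w) {t : ℕ} (ht : 1 ≤ t)
    (i j : Fin n) : w ^ (n * B) ≤ N.transition t (n * B) i j := by
  have h := hN.le_card_transition hw ht j n
  rw [min_eq_left (by omega)] at h
  have huniv : (Finset.univ.filter fun i => w ^ (n * B) ≤ N.transition t (n * B) i j) =
      Finset.univ :=
    Finset.eq_univ_of_card _ (le_antisymm (Finset.card_le_univ _) (by simpa using h))
  have hi := Finset.mem_univ i
  rw [← huniv] at hi
  exact (Finset.mem_filter.1 hi).2

variable {E : Type*} [NormedAddCommGroup E] [NormedSpace ℝ E]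

/-- The deviation from unperturbed averaging obeys the same recursion from zero, and averaging with
a stochastic matrix cannot increase its spread; perturbations therefore only add up. -/
theorem Regular.spread_sub_transition_le (hN : N.Regular w B) {u δ : ℕ → Fin n → E}
    (hu : ∀ t, 1 ≤ t → u (t + 1) = mix (N.W t) (u t) + δ (t + 1)) {t : ℕ} (ht : 1 ≤ t) (l : ℕ) :
    spread (u (t + l) - mix (N.transition t l) (u t)) ≤
      ∑ k ∈ Finset.range l, spread (δ (t + k + 1)) := by
  induction l with
  | zero =>
    rw [transition, mix_one, add_zero, sub_self, Finset.sum_range_zero]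
    exact spread_le le_rfl fun i j => by simp
  | succ l ih =>
    have h : u (t + (l + 1)) - mix (N.transition t (l + 1)) (u t) =
        mix (N.W (t + l)) (u (t + l) - mix (N.transition t l) (u t)) + δ (t + l + 1) := by
      rw [transition, mix_mul, mix_sub, ← add_assoc, hu (t + l) (by omega)]; abel
    rw [h, Finset.sum_range_succ]
    refine (spread_add_le _ _).trans (add_le_add_left ?_ _)
    refine (spread_mix_le (η := 0) (fun i j => hN.nonneg (by omega) i j)
      (hN.row_sum _ (by omega)) _).trans ?_
    simpa using ih

theorem Regular.spread_add_le (hN : N.Regular w B) (hw : 0 ≤ w) {u δ : ℕ → Fin n → E}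
    (hu : ∀ t, 1 ≤ t → u (t + 1) = mix (N.W t) (u t) + δ (t + 1)) {t : ℕ} (ht : 1 ≤ t) :
    spread (u (t + n * B)) ≤ (1 - n * w ^ (n * B)) * spread (u t) +
      ∑ k ∈ Finset.range (n * B), spread (δ (t + k + 1)) := by
  have h1 := hN.spread_sub_transition_le hu ht (n * B)
  have h2 := spread_mix_le (hN.transition_ge hw ht) (hN.transition_row_sum ht (n * B)) (u t)
  have h3 := EventTriggered.spread_add_le (mix (N.transition t (n * B)) (u t))
    (u (t + n * B) - mix (N.transition t (n * B)) (u t))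
  rw [add_sub_cancel] at h3
  linarith

/-- The accumulated disagreement of perturbed averaging is bounded by the accumulated
perturbations. -/
theorem Regular.sum_spread_le (hN : N.Regular w B) (hw : 0 < w) (hn : 1 ≤ n) {V₀ : ℝ}
    {u δ : ℕ → Fin n → E}
    (hu : ∀ t, 1 ≤ t → u (t + 1) = mix (N.W t) (u t) + δ (t + 1))
    (hV : ∀ t, 1 ≤ t → spread (u t) ≤ V₀) (T : ℕ) :
    ∑ t ∈ Finset.Icc 1 T, spread (u t) ≤
      (n * B) / (n * w ^ (n * B)) * (V₀ + ∑ t ∈ Finset.Icc 2 T, spread (δ t)) := by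
  set L := n * B with hL
  have hn' : (0 : ℝ) < n := by exact_mod_cast hn
  have hη : 0 < n * w ^ L := by positivity
  have hc : 0 ≤ 1 - n * w ^ L := by
    have h := hN.transition_row_sum le_rfl L ⟨0, hn⟩
    rw [← h, sub_nonneg]
    calc n * w ^ L = ∑ j : Fin n, w ^ L := by simp
      _ ≤ _ := Finset.sum_le_sum fun j _ => hN.transition_ge hw.le le_rfl _ j
  set D := ∑ t ∈ Finset.Icc 2 T, spread (δ t) with hD
  have hD0 : 0 ≤ D := Finset.sum_nonneg fun _ _ => spread_nonneg _
  set Sp := ∑ t ∈ Finset.Icc 1 T, spread (u t) with hSp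
  have hSp0 : 0 ≤ Sp := Finset.sum_nonneg fun _ _ => spread_nonneg _
  have hsplit : Sp ≤ ∑ t ∈ Finset.Icc 1 L, spread (u t) +
      ∑ t ∈ Finset.Icc 1 (T - L), spread (u (t + L)) := by
    have himg : ∑ t ∈ Finset.Icc 1 (T - L), spread (u (t + L)) =
        ∑ t ∈ (Finset.Icc 1 (T - L)).map (addRightEmbedding L), spread (u t) := by
      rw [Finset.sum_map]; rfl
    rw [himg, hSp]
    have hsub : Finset.Icc 1 T ⊆
        Finset.Icc 1 L ∪ (Finset.Icc 1 (T - L)).map (addRightEmbedding L) := by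
      intro t ht
      rw [Finset.mem_Icc] at ht
      rw [Finset.mem_union]
      by_cases h : t ≤ L
      · exact Or.inl (Finset.mem_Icc.2 ⟨ht.1, h⟩)
      · refine Or.inr (Finset.mem_map.2 ⟨t - L, Finset.mem_Icc.2 ⟨by omega, by omega⟩, ?_⟩)
        simp only [addRightEmbedding_apply]; omega
    refine (Finset.sum_le_sum_of_subset_of_nonneg hsub fun _ _ _ => spread_nonneg _).trans ?_
    rw [← Finset.sum_union_inter]
    linarith [Finset.sum_nonneg (s := Finset.Icc 1 L ∩
      (Finset.Icc 1 (T - L)).map (addRightEmbedding L)) fun t _ => spread_nonneg (u t)]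
  have hhead : ∑ t ∈ Finset.Icc 1 L, spread (u t) ≤ L * V₀ := by
    refine (Finset.sum_le_sum fun t ht => hV t (Finset.mem_Icc.1 ht).1).trans ?_
    simp
  -- After summation each perturbation is counted at most `L` times. The term `(1 - n * w ^ L) * Sp`
  -- is then absorbed into the left side, which avoids unrolling a geometric series.
  have htail : ∑ t ∈ Finset.Icc 1 (T - L), spread (u (t + L)) ≤
      (1 - n * w ^ L) * Sp + L * D := by
    calc ∑ t ∈ Finset.Icc 1 (T - L), spread (u (t + L))
        ≤ ∑ t ∈ Finset.Icc 1 (T - L), ((1 - n * w ^ L) * spread (u t) +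
            ∑ k ∈ Finset.range L, spread (δ (t + k + 1))) :=
          Finset.sum_le_sum fun t ht => hN.spread_add_le hw.le hu (Finset.mem_Icc.1 ht).1
      _ = (1 - n * w ^ L) * ∑ t ∈ Finset.Icc 1 (T - L), spread (u t) +
            ∑ k ∈ Finset.range L, ∑ t ∈ Finset.Icc 1 (T - L), spread (δ (t + k + 1)) := by
          rw [Finset.sum_add_distrib, Finset.mul_sum, Finset.sum_comm (s := Finset.range L)]
      _ ≤ (1 - n * w ^ L) * Sp + ∑ k ∈ Finset.range L, D := by
          refine add_le_add (mul_le_mul_of_nonneg_left ?_ hc) (Finset.sum_le_sum fun k hk => ?_)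
          · exact Finset.sum_le_sum_of_subset_of_nonneg
              (Finset.Icc_subset_Icc_right (by omega)) fun _ _ _ => spread_nonneg _
          · have himg : ∑ t ∈ Finset.Icc 1 (T - L), spread (δ (t + k + 1)) =
                ∑ t ∈ (Finset.Icc 1 (T - L)).map (addRightEmbedding (k + 1)), spread (δ t) := by
              rw [Finset.sum_map]; rfl
            rw [himg]
            refine Finset.sum_le_sum_of_subset_of_nonneg (fun t ht => ?_)
              fun _ _ _ => spread_nonneg _
            obtain ⟨r, hr, rfl⟩ := Finset.mem_map.1 ht
            rw [Finset.mem_Icc] at hr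
            have := Finset.mem_range.1 hk
            simp only [addRightEmbedding_apply, Finset.mem_Icc]
            omega
      _ = (1 - n * w ^ L) * Sp + L * D := by simp
  rw [div_mul_eq_mul_div, le_div_iff₀ hη]
  have hLc : (L : ℝ) = n * B := by rw [hL]; push_cast; ring
  rw [hLc] at hhead htail
  nlinarith

end Network

/-! ### Projections and elementary one-step inequalities. -/

section Orthant

variable {ι : Type*}

@[simp]
theorem orthantProj_apply (v : EuclideanSpace ℝ ι) (k : ι) : orthantProj v k = max (v k) 0 := rfl

variable [Fintype ι]

theorem norm_orthantProj_sub_le {μ : EuclideanSpace ℝ ι} (hμ : ∀ k, 0 ≤ μ k)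
    (v : EuclideanSpace ℝ ι) : ‖orthantProj v - μ‖ ≤ ‖v - μ‖ := by
  rw [EuclideanSpace.norm_eq, EuclideanSpace.norm_eq]
  refine Real.sqrt_le_sqrt (Finset.sum_le_sum fun k _ => ?_)
  rw [Real.norm_eq_abs, Real.norm_eq_abs, PiLp.sub_apply, PiLp.sub_apply, orthantProj_apply]
  refine pow_le_pow_left₀ (abs_nonneg _) ?_ 2
  calc |max (v k) 0 - μ k| = |max (v k) 0 - max (μ k) 0| := by rw [max_eq_left (hμ k)]
    _ ≤ |v k - μ k| := abs_max_sub_max_le_abs _ _ _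

theorem norm_orthantProj_le (v : EuclideanSpace ℝ ι) : ‖orthantProj v‖ ≤ ‖v‖ := by
  have h := norm_orthantProj_sub_le (μ := 0) (fun _ => le_rfl) v
  simpa using h

theorem abs_apply_le_norm (v : EuclideanSpace ℝ ι) (k : ι) : |v k| ≤ ‖v‖ := by
  simpa using PiLp.norm_apply_le v k

theorem norm_le_sum_abs (v : EuclideanSpace ℝ ι) : ‖v‖ ≤ ∑ k, |v k| := by
  rw [EuclideanSpace.norm_eq]
  refine Real.sqrt_le_iff.2 ⟨Finset.sum_nonneg fun _ _ => abs_nonneg _, ?_⟩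
  simp only [Real.norm_eq_abs]
  exact Finset.sum_sq_le_sq_sum_of_nonneg fun k _ => abs_nonneg (v k)

end Orthant

/-- An identity in disguise: expand around `q - μ` with increment `γ • (b - β • q)` and rewrite the
inner product of `q` with `q - μ` by polarization. The regularization `β` shrinks the distance at
the price of `γ * β * ‖μ‖ ^ 2`. -/
theorem norm_relaxed_step_sub_sq_le {E : Type*} [NormedAddCommGroup E] [InnerProductSpace ℝ E]
    {β γ : ℝ} (q b μ : E) :
    ‖(1 - β * γ) • q + γ • b - μ‖ ^ 2 ≤ (1 - β * γ) * ‖q - μ‖ ^ 2 + 2 * γ * inner ℝ b (q - μ)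
      + γ * β * ‖μ‖ ^ 2 + γ ^ 2 * ‖b - β • q‖ ^ 2 - γ * β * ‖q‖ ^ 2 := by
  have h1 : (1 - β * γ) • q + γ • b - μ = (q - μ) + γ • (b - β • q) := by module
  have h2 : ‖μ‖ ^ 2 = ‖q‖ ^ 2 - 2 * inner ℝ q (q - μ) + ‖q - μ‖ ^ 2 := by
    rw [← norm_sub_sq_real, sub_sub_cancel]
  rw [h1, norm_add_sq_real, h2, inner_smul_right, inner_sub_right, real_inner_smul_right,
    norm_smul, mul_pow, Real.norm_eq_abs, sq_abs, real_inner_comm b, real_inner_comm q]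
  apply le_of_eq
  ring

theorem IsProjection.inner_le_zero {p : ℕ} {X : Set (Vec p)} (hX : Convex ℝ X) {v x : Vec p}
    (h : IsProjection X v x) {y : Vec p} (hy : y ∈ X) : inner ℝ (v - x) (y - x) ≤ 0 := by
  refine (norm_eq_iInf_iff_real_inner_le_zero hX h.1).1 ?_ y hy
  have : Nonempty X := ⟨⟨x, h.1⟩⟩
  refine le_antisymm (le_ciInf fun w => h.2 w w.2) ?_
  exact ciInf_le ⟨0, by rintro _ ⟨w, rfl⟩; exact norm_nonneg _⟩ (⟨x, h.1⟩ : X)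

/-- The variational inequality at the projected point, with the three squares produced by
polarization. The term `- ‖x - z‖ ^ 2` is kept because it later absorbs the consensus steps. -/
theorem IsProjection.inner_le {p : ℕ} {X : Set (Vec p)} (hX : Convex ℝ X) {α : ℝ} (hα : 0 < α)
    {z ω x y : Vec p} (h : IsProjection X (z - α • ω) x) (hy : y ∈ X) :
    inner ℝ ω (x - y) ≤ (‖z - y‖ ^ 2 - ‖x - y‖ ^ 2 - ‖x - z‖ ^ 2) / (2 * α) := by
  have h1 := h.inner_le_zero hX hy
  have h2 : z - α • ω - x = (z - x) - α • ω := by abel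
  have h3 : ‖z - y‖ ^ 2 = ‖x - z‖ ^ 2 - 2 * inner ℝ (z - x) (y - x) + ‖x - y‖ ^ 2 := by
    rw [show z - y = (z - x) - (y - x) by abel, norm_sub_sq_real, norm_sub_rev z x,
      norm_sub_rev y x]
  rw [h2, inner_sub_left, real_inner_smul_left] at h1
  have h4 : inner ℝ ω (x - y) = - inner ℝ ω (y - x) := by rw [← inner_neg_right, neg_sub]
  rw [le_div_iff₀ (by positivity), h4]
  linarith

/-! ### Lipschitz consequences of bounded subgradients. -/

namespace Problem.Regular

variable {n p : ℕ} {m : Fin n → ℕ} {P : Problem n p m} {R F₁ F₂ : ℝ}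

theorem norm_sub_le (hP : P.Regular R F₁ F₂) {x y : Vec p} (hx : x ∈ P.X) (hy : y ∈ P.X) :
    ‖x - y‖ ≤ 2 * R := by
  have := _root_.norm_sub_le x y
  linarith [hP.norm_le x hx, hP.norm_le y hy]

theorem loss_sub_le (hP : P.Regular R F₁ F₂) {i : Fin n} {t : ℕ} (ht : 1 ≤ t) {x y : Vec p}
    (hx : x ∈ P.X) (hy : y ∈ P.X) : P.f i t x - P.f i t y ≤ F₂ * ‖x - y‖ := by
  obtain ⟨s, hs, hsF⟩ := hP.loss_subgradient i t ht x hx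
  have h := hs y hy
  have h1 : inner ℝ s (y - x) = - inner ℝ s (x - y) := by rw [← inner_neg_right, neg_sub]
  have h2 := real_inner_le_norm s (x - y)
  have h3 := mul_le_mul_of_nonneg_right hsF (norm_nonneg (x - y))
  linarith

theorem constraint_sub_le (hP : P.Regular R F₁ F₂) {i : Fin n} {t : ℕ} (ht : 1 ≤ t) {x y : Vec p}
    (hx : x ∈ P.X) (hy : y ∈ P.X) (k : Fin (m i)) :
    P.g i t x k - P.g i t y k ≤ F₂ * ‖x - y‖ := by
  obtain ⟨J, hJ, hJF⟩ := hP.constraint_subgradient i t ht x hx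
  have h := hJ y hy k
  have h1 : |J (y - x) k| ≤ F₂ * ‖x - y‖ := by
    rw [norm_sub_rev]
    exact (abs_apply_le_norm _ k).trans (J.le_of_opNorm_le hJF _)
  linarith [neg_abs_le (J (y - x) k)]

theorem max_constraint_le (hP : P.Regular R F₁ F₂) {i : Fin n} {t : ℕ} (ht : 1 ≤ t)
    {x y : Vec p} (hx : x ∈ P.X) (hy : y ∈ P.X) (k : Fin (m i)) :
    max (P.g i t x k) 0 ≤ max (P.g i t y k) 0 + F₂ * ‖x - y‖ := by
  have h0 : 0 ≤ F₂ * ‖x - y‖ := by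
    obtain ⟨J, -, hJF⟩ := hP.constraint_subgradient i t ht x hx
    exact mul_nonneg ((norm_nonneg J).trans hJF) (norm_nonneg _)
  have h := hP.constraint_sub_le ht hx hy k
  refine max_le ?_ (add_nonneg (le_max_right _ _) h0)
  linarith [le_max_left (P.g i t y k) 0]

end Problem.Regular

/-! ### One round of a single agent. -/

namespace Trajectory.IsGenerated

variable {n p : ℕ} {m : Fin n → ℕ} {S : Trajectory n p m} {P : Problem n p m} {N : Network n}
  {c : Params} {R F₁ F₂ w : ℝ} {B : ℕ}

theorem x_mem (hS : S.IsGenerated P N c F₂) (i : Fin n) {t : ℕ} (ht : 1 ≤ t) : S.x i t ∈ P.X := by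
  obtain ⟨t, rfl⟩ := Nat.exists_eq_add_of_le' ht
  rcases Nat.eq_zero_or_pos t with rfl | h
  · exact hS.x_init i
  · exact (hS.x_step i t h).1

theorem xhat_mem (hS : S.IsGenerated P N c F₂) (i : Fin n) {t : ℕ} (ht : 1 ≤ t) :
    S.xhat i t ∈ P.X := by
  induction t, ht using Nat.le_induction with
  | base => rw [hS.xhat_init]; exact hS.x_init i
  | succ t ht ih =>
    rcases le_or_gt (c.τ (t + 1)) ‖S.x i (t + 1) - S.xhat i t‖ with h | h
    · rw [hS.xhat_trigger i t ht h]; exact hS.x_mem i (by omega)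
    · rw [hS.xhat_keep i t ht h]; exact ih

theorem norm_xhat_sub_x_le (hS : S.IsGenerated P N c F₂) (i : Fin n) {t : ℕ} (ht : 2 ≤ t)
    (hτ : 0 ≤ c.τ t) : ‖S.xhat i t - S.x i t‖ ≤ c.τ t := by
  obtain ⟨t, rfl⟩ := Nat.exists_eq_add_of_le' (show 1 ≤ t by omega)
  rcases le_or_gt (c.τ (t + 1)) ‖S.x i (t + 1) - S.xhat i t‖ with h | h
  · rw [hS.xhat_trigger i t (by omega) h]; simpa using hτ
  · rw [hS.xhat_keep i t (by omega) h, norm_sub_rev]; exact h.le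

theorem q_nonneg (hS : S.IsGenerated P N c F₂) (i : Fin n) {t : ℕ} (ht : 1 ≤ t) (k : Fin (m i)) :
    0 ≤ S.q i t k := by
  obtain ⟨t, rfl⟩ := Nat.exists_eq_add_of_le' ht
  rcases Nat.eq_zero_or_pos t with rfl | h
  · rw [hS.q_init i]; simp
  · rw [hS.q_step i t h, orthantProj_apply]; exact le_max_right _ _

/-- The vector that drives the dual update. -/
def _root_.EventTriggered.Trajectory.dualDrift (S : Trajectory n p m) (P : Problem n p m)
    (i : Fin n) (t : ℕ) : Vec (m i) :=
  orthantProj (P.g i t (S.x i t)) + S.dgp i t (S.x i (t + 1) - S.x i t)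

theorem norm_dualDrift_le (hS : S.IsGenerated P N c F₂) (hP : P.Regular R F₁ F₂)
    (i : Fin n) {t : ℕ} (ht : 1 ≤ t) : ‖S.dualDrift P i t‖ ≤ F₁ + F₂ * (2 * R) := by
  have hF₂ : 0 ≤ F₂ := (norm_nonneg _).trans (hS.dgp_bound i t ht)
  refine (norm_add_le _ _).trans (add_le_add ?_ ?_)
  · exact (norm_orthantProj_le _).trans (hP.constraint_bound i t ht _ (hS.x_mem i ht))
  · refine ((S.dgp i t).le_of_opNorm_le (hS.dgp_bound i t ht) _).trans ?_
    exact mul_le_mul_of_nonneg_left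
      (hP.norm_sub_le (hS.x_mem i (by omega)) (hS.x_mem i ht)) hF₂

/-- At a feasible `y` the clipped constraint vanishes, so its linearization at the current decision
is componentwise nonpositive at `y`; pairing with `q ≥ 0` keeps the sign. This converts the dual
term into the constraint part of the update direction. -/
theorem inner_dualDrift_le (hS : S.IsGenerated P N c F₂) (i : Fin n) {t : ℕ} (ht : 1 ≤ t)
    {y : Vec p} (hy : y ∈ P.X) (hg : ∀ k, P.g i t y k ≤ 0) :
    inner ℝ (S.dualDrift P i t) (S.q i t) ≤
      inner ℝ (ContinuousLinearMap.adjoint (S.dgp i t) (S.q i t)) (S.x i (t + 1) - y) := by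
  rw [ContinuousLinearMap.adjoint_inner_left, real_inner_comm, ← sub_nonpos, ← inner_sub_right,
    dualDrift, add_sub_assoc, ← map_sub, PiLp.inner_apply]
  refine Finset.sum_nonpos fun k _ => ?_
  have h := hS.dgp_subgradient i t ht y hy k
  have h2 : S.x i (t + 1) - S.x i t - (S.x i (t + 1) - y) = y - S.x i t := by abel
  simp only [orthantProj_apply, max_eq_right (hg k)] at h
  have h3 : (orthantProj (P.g i t (S.x i t)) + S.dgp i t (y - S.x i t)) k ≤ 0 := by
    rw [PiLp.add_apply, orthantProj_apply]; exact h
  rw [h2]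
  have h4 := mul_nonpos_of_nonpos_of_nonneg h3 (hS.q_nonneg i ht k)
  simpa using h4

/-- Subgradients are taken at the old decision but the projection inequality holds at the new one.
The mismatch costs `F₂` times the movement for the loss and `F₂ * ‖μ‖` times it for the linearized
constraint. -/
theorem primal_step (hS : S.IsGenerated P N c F₂) (hP : P.Regular R F₁ F₂)
    (i : Fin n) {t : ℕ} (ht : 1 ≤ t) (hα : 0 < c.α (t + 1)) {μ : Vec (m i)}
    {y : Vec p} (hy : y ∈ P.X) (hg : ∀ k, P.g i t y k ≤ 0) :
    P.f i t (S.x i t) - P.f i t y + inner ℝ (orthantProj (P.g i t (S.x i t))) μ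
        + inner ℝ (S.dualDrift P i t) (S.q i t - μ) ≤
      F₂ * (1 + ‖μ‖) * ‖S.x i t - S.x i (t + 1)‖
        + (‖S.z i (t + 1) - y‖ ^ 2 - ‖S.x i (t + 1) - y‖ ^ 2
          - ‖S.x i (t + 1) - S.z i (t + 1)‖ ^ 2) / (2 * c.α (t + 1)) := by
  have h1 := hS.df_subgradient i t ht y hy
  have h2 := (hS.x_step i t ht).inner_le hP.convex_set hα hy
  have h3 := hS.inner_dualDrift_le i ht hy hg
  rw [hS.ω_step i t ht, inner_add_left] at h2
  have h4 : inner ℝ (S.df i t) (y - S.x i t) =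
      - inner ℝ (S.df i t) (S.x i (t + 1) - y)
        - inner ℝ (S.df i t) (S.x i t - S.x i (t + 1)) := by
    rw [← inner_neg_right, ← inner_sub_right]; congr 1; abel
  have h5 : inner ℝ (S.df i t) (S.x i t - S.x i (t + 1)) ≤ F₂ * ‖S.x i t - S.x i (t + 1)‖ :=
    (real_inner_le_norm _ _).trans
      (mul_le_mul_of_nonneg_right (hS.df_bound i t ht) (norm_nonneg _))
  have h6 : - inner ℝ (S.dgp i t (S.x i (t + 1) - S.x i t)) μ ≤
      F₂ * ‖S.x i t - S.x i (t + 1)‖ * ‖μ‖ := by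
    rw [← inner_neg_left]
    refine (real_inner_le_norm _ _).trans (mul_le_mul_of_nonneg_right ?_ (norm_nonneg _))
    rw [norm_neg, norm_sub_rev (S.x i t)]
    exact (S.dgp i t).le_of_opNorm_le (hS.dgp_bound i t ht) _
  have h7 : inner ℝ (S.dualDrift P i t) μ = inner ℝ (orthantProj (P.g i t (S.x i t))) μ +
      inner ℝ (S.dgp i t (S.x i (t + 1) - S.x i t)) μ := inner_add_left _ _ _
  rw [inner_sub_right]
  linarith

section Power

variable {α₀ τ₀ θ₁ θ₂ θ₃ : ℝ}

theorem powerParams_β_mul_γ {t : ℕ} (ht : 1 ≤ t) :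
    (powerParams α₀ τ₀ θ₁ θ₂ θ₃).β t * (powerParams α₀ τ₀ θ₁ θ₂ θ₃).γ t = 1 / t := by
  have ht' : (0 : ℝ) < t := by exact_mod_cast ht
  simp only [powerParams]
  rw [div_mul_div_comm, ← Real.rpow_add ht']
  simp

/-- Since `β γ = 1 / t`, the unclipped update is a convex combination of the old dual variable and
`t ^ θ₂` times the bounded drift, so the bound propagates with the same constant. -/
theorem norm_q_le (hS : S.IsGenerated P N (powerParams α₀ τ₀ θ₁ θ₂ θ₃) F₂)
    (hP : P.Regular R F₁ F₂) (hF : 0 ≤ F₁ + F₂ * (2 * R)) (hθ₂ : 0 ≤ θ₂) (i : Fin n) {t : ℕ}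
    (ht : 1 ≤ t) : ‖S.q i t‖ ≤ (F₁ + F₂ * (2 * R)) * (t : ℝ) ^ θ₂ := by
  set F := F₁ + F₂ * (2 * R)
  induction t, ht using Nat.le_induction with
  | base => rw [hS.q_init i]; simpa using hF
  | succ t ht ih =>
    have ht0 : (0 : ℝ) < t := by exact_mod_cast ht
    have ht1 : (0 : ℝ) < ((t + 1 : ℕ) : ℝ) := by positivity
    rw [hS.q_step i t ht, powerParams_β_mul_γ (by omega)]
    refine (norm_orthantProj_le _).trans ((norm_add_le _ _).trans ?_)
    have hb := hS.norm_dualDrift_le hP i ht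
    have hγ : (powerParams α₀ τ₀ θ₁ θ₂ θ₃).γ (t + 1) = ((t + 1 : ℕ) : ℝ) ^ θ₂ / ((t + 1 : ℕ) : ℝ) := by
      simp only [powerParams]
      rw [Real.rpow_sub ht1, Real.rpow_one, one_div_div]
    have hc : (0 : ℝ) ≤ 1 - 1 / ((t + 1 : ℕ) : ℝ) := by
      rw [sub_nonneg, div_le_one ht1]; push_cast; linarith
    have hpow : (t : ℝ) ^ θ₂ ≤ ((t + 1 : ℕ) : ℝ) ^ θ₂ :=
      Real.rpow_le_rpow ht0.le (by push_cast; linarith) hθ₂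
    have hp0 : 0 < ((t + 1 : ℕ) : ℝ) ^ θ₂ := Real.rpow_pos_of_pos ht1 _
    rw [norm_smul, norm_smul, hγ, Real.norm_of_nonneg hc, Real.norm_of_nonneg (by positivity)]
    have h1 := mul_le_mul_of_nonneg_left (ih.trans (mul_le_mul_of_nonneg_left hpow hF)) hc
    have h2 := mul_le_mul_of_nonneg_left hb
      (show 0 ≤ ((t + 1 : ℕ) : ℝ) ^ θ₂ / ((t + 1 : ℕ) : ℝ) by positivity)
    refine (add_le_add h1 h2).trans (le_of_eq ?_)
    ring

/-- Dividing the distance recursion by `2 γ` isolates the drift; the growth bound on `q` makes `β •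
q` bounded, so the second-order term is of order `γ`. -/
theorem dual_step (hS : S.IsGenerated P N (powerParams α₀ τ₀ θ₁ θ₂ θ₃) F₂)
    (hP : P.Regular R F₁ F₂) (hF : 0 ≤ F₁ + F₂ * (2 * R)) (hθ₂ : 0 ≤ θ₂) (i : Fin n) {t : ℕ}
    (ht : 1 ≤ t) {μ : Vec (m i)} (hμ : ∀ k, 0 ≤ μ k) :
    - inner ℝ (S.dualDrift P i t) (S.q i t - μ) ≤
      ((t : ℝ) ^ (1 - θ₂) * ‖S.q i t - μ‖ ^ 2
        - ((t + 1 : ℕ) : ℝ) ^ (1 - θ₂) * ‖S.q i (t + 1) - μ‖ ^ 2) / 2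
      + 1 / ((t + 1 : ℕ) : ℝ) ^ θ₂ * ‖μ‖ ^ 2 / 2
      + 2 * (F₁ + F₂ * (2 * R)) ^ 2 * (1 / ((t + 1 : ℕ) : ℝ) ^ (1 - θ₂)) := by
  set F := F₁ + F₂ * (2 * R)
  set b := S.dualDrift P i t
  have ht0 : (0 : ℝ) < t := by exact_mod_cast ht
  have ht1 : (0 : ℝ) < ((t + 1 : ℕ) : ℝ) := by positivity
  have hβγ := powerParams_β_mul_γ (α₀ := α₀) (τ₀ := τ₀) (θ₁ := θ₁) (θ₂ := θ₂) (θ₃ := θ₃)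
    (t := t + 1) (by omega)
  have hβ : (powerParams α₀ τ₀ θ₁ θ₂ θ₃).β (t + 1) = 1 / ((t + 1 : ℕ) : ℝ) ^ θ₂ := rfl
  have hγ : (powerParams α₀ τ₀ θ₁ θ₂ θ₃).γ (t + 1) = 1 / ((t + 1 : ℕ) : ℝ) ^ (1 - θ₂) := rfl
  set β := (powerParams α₀ τ₀ θ₁ θ₂ θ₃).β (t + 1)
  set γ := (powerParams α₀ τ₀ θ₁ θ₂ θ₃).γ (t + 1)
  have hp : 0 < ((t + 1 : ℕ) : ℝ) ^ (1 - θ₂) := Real.rpow_pos_of_pos ht1 _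
  have hp' : 0 < ((t + 1 : ℕ) : ℝ) ^ θ₂ := Real.rpow_pos_of_pos ht1 _
  have hγ0 : 0 < γ := by rw [hγ]; positivity
  have hβ0 : 0 < β := by rw [hβ]; positivity
  have hq := hS.norm_q_le hP hF hθ₂ i ht
  have hbq : ‖b - β • S.q i t‖ ≤ 2 * F := by
    refine (_root_.norm_sub_le _ _).trans ?_
    have h1 : ‖β • S.q i t‖ ≤ F := by
      rw [norm_smul, Real.norm_of_nonneg hβ0.le, hβ, one_div_mul_eq_div, div_le_iff₀ hp']
      exact hq.trans (mul_le_mul_of_nonneg_left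
        (Real.rpow_le_rpow ht0.le (by push_cast; linarith) hθ₂) hF)
    linarith [hS.norm_dualDrift_le hP i ht]
  have hbq2 : ‖b - β • S.q i t‖ ^ 2 ≤ (2 * F) ^ 2 := pow_le_pow_left₀ (norm_nonneg _) hbq 2
  have h1 : ‖S.q i (t + 1) - μ‖ ^ 2 ≤ ‖(1 - β * γ) • S.q i t + γ • b - μ‖ ^ 2 := by
    rw [hS.q_step i t ht]
    exact pow_le_pow_left₀ (norm_nonneg _) (norm_orthantProj_sub_le hμ _) 2
  have h2 := h1.trans (norm_relaxed_step_sub_sq_le (β := β) (γ := γ) (S.q i t) b μ)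
  have h3 : 0 ≤ γ * β * ‖S.q i t‖ ^ 2 := by positivity
  have h4 := mul_le_mul_of_nonneg_left hbq2 (sq_nonneg γ)
  have h5 : ‖S.q i (t + 1) - μ‖ ^ 2 ≤ (1 - β * γ) * ‖S.q i t - μ‖ ^ 2
      + γ * (2 * inner ℝ b (S.q i t - μ) + β * ‖μ‖ ^ 2 + γ * (2 * F) ^ 2) := by linarith
  have h6 := mul_le_mul_of_nonneg_left h5 hp.le
  have h7 : ((t + 1 : ℕ) : ℝ) ^ (1 - θ₂) * γ = 1 := by rw [hγ, mul_one_div_cancel hp.ne']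
  -- The contraction factor is `t / (t + 1)`, which turns the weight `1 / γ` of round `t + 1` into
  -- at most that of round `t`: the weighted dual distances telescope without remainder.
  have h8 : ((t + 1 : ℕ) : ℝ) ^ (1 - θ₂) * (1 - β * γ) ≤ (t : ℝ) ^ (1 - θ₂) := by
    have e1 : (1 : ℝ) - 1 / ((t + 1 : ℕ) : ℝ) = t / ((t + 1 : ℕ) : ℝ) := by
      field_simp; push_cast; ring
    rw [hβγ, e1, Real.rpow_sub ht1, Real.rpow_sub ht0, Real.rpow_one, Real.rpow_one]
    calc ((t + 1 : ℕ) : ℝ) / ((t + 1 : ℕ) : ℝ) ^ θ₂ * (t / ((t + 1 : ℕ) : ℝ))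
        = t / ((t + 1 : ℕ) : ℝ) ^ θ₂ := by field_simp
      _ ≤ t / (t : ℝ) ^ θ₂ := by
        gcongr
        linarith
  have h9 := mul_le_mul_of_nonneg_right h8 (sq_nonneg ‖S.q i t - μ‖)
  rw [mul_add, ← mul_assoc, ← mul_assoc, h7] at h6
  rw [← hβ, ← hγ]
  linarith

theorem agent_step (hS : S.IsGenerated P N (powerParams α₀ τ₀ θ₁ θ₂ θ₃) F₂)
    (hP : P.Regular R F₁ F₂) (hF : 0 ≤ F₁ + F₂ * (2 * R)) (hθ₂ : 0 ≤ θ₂) (hα₀ : 0 < α₀)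
    (i : Fin n) {t : ℕ} (ht : 1 ≤ t) {μ : Vec (m i)} (hμ : ∀ k, 0 ≤ μ k)
    {y : Vec p} (hy : y ∈ P.X) (hg : ∀ k, P.g i t y k ≤ 0) :
    P.f i t (S.x i t) - P.f i t y + inner ℝ (orthantProj (P.g i t (S.x i t))) μ ≤
      F₂ * (1 + ‖μ‖) * ‖S.x i t - S.x i (t + 1)‖
        + (‖S.z i (t + 1) - y‖ ^ 2 - ‖S.x i (t + 1) - y‖ ^ 2
          - ‖S.x i (t + 1) - S.z i (t + 1)‖ ^ 2) * (((t + 1 : ℕ) : ℝ) ^ θ₁ / (2 * α₀))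
      + ((t : ℝ) ^ (1 - θ₂) * ‖S.q i t - μ‖ ^ 2
        - ((t + 1 : ℕ) : ℝ) ^ (1 - θ₂) * ‖S.q i (t + 1) - μ‖ ^ 2) / 2
      + 1 / ((t + 1 : ℕ) : ℝ) ^ θ₂ * ‖μ‖ ^ 2 / 2
      + 2 * (F₁ + F₂ * (2 * R)) ^ 2 * (1 / ((t + 1 : ℕ) : ℝ) ^ (1 - θ₂)) := by
  have hp : 0 < ((t + 1 : ℕ) : ℝ) ^ θ₁ := Real.rpow_pos_of_pos (by positivity) _
  have hα : 0 < (powerParams α₀ τ₀ θ₁ θ₂ θ₃).α (t + 1) := div_pos hα₀ hp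
  have h1 := hS.primal_step hP i ht hα (μ := μ) hy hg
  have h2 := hS.dual_step hP hF hθ₂ i ht hμ
  have h3 : ∀ r : ℝ, r / (2 * (powerParams α₀ τ₀ θ₁ θ₂ θ₃).α (t + 1)) =
      r * (((t + 1 : ℕ) : ℝ) ^ θ₁ / (2 * α₀)) := fun r => by
    simp only [powerParams]; field_simp
  rw [h3] at h1
  linarith

end Power

end Trajectory.IsGenerated

/-! ### Network-wide error quantities and summation over agents and rounds. -/

namespace Trajectory

variable {n p : ℕ} {m : Fin n → ℕ}

/-- Total deviation of the broadcast decisions from the decisions at time `t`. -/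
def triggerError (S : Trajectory n p m) (t : ℕ) : ℝ := ∑ i, ‖S.xhat i t - S.x i t‖

/-- Total deviation of the decisions from the consensus variables at time `t`. -/
def consensusStep (S : Trajectory n p m) (t : ℕ) : ℝ := ∑ i, ‖S.x i t - S.z i t‖

/-- Disagreement of the broadcast decisions at time `t`. -/
def disagreement (S : Trajectory n p m) (t : ℕ) : ℝ := spread fun i => S.xhat i t

/-- Total violation of the local constraints at time `t`, in the `ℓ¹` norm. -/
def localViolation (S : Trajectory n p m) (P : Problem n p m) (t : ℕ) : ℝ :=
  ∑ i, ∑ k, max (P.g i t (S.x i t) k) 0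

theorem triggerError_nonneg (S : Trajectory n p m) (t : ℕ) : 0 ≤ S.triggerError t :=
  Finset.sum_nonneg fun _ _ => norm_nonneg _

theorem consensusStep_nonneg (S : Trajectory n p m) (t : ℕ) : 0 ≤ S.consensusStep t :=
  Finset.sum_nonneg fun _ _ => norm_nonneg _

theorem disagreement_nonneg (S : Trajectory n p m) (t : ℕ) : 0 ≤ S.disagreement t :=
  spread_nonneg _

theorem norm_x_sub_x_le (S : Trajectory n p m) (t : ℕ) (i j : Fin n) :
    ‖S.x i t - S.x j t‖ ≤
      S.disagreement t + ‖S.xhat i t - S.x i t‖ + ‖S.xhat j t - S.x j t‖ := by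
  have h : S.x i t - S.x j t =
      (S.xhat i t - S.xhat j t) - (S.xhat i t - S.x i t) + (S.xhat j t - S.x j t) := by abel
  rw [h]
  refine (norm_add_le _ _).trans (add_le_add_left ((norm_sub_le _ _).trans ?_) _)
  exact add_le_add_left (norm_sub_le_spread (fun i => S.xhat i t) i j) _

end Trajectory

theorem norm_sub_sq_sub_norm_sub_sq_le {E : Type*} [NormedAddCommGroup E] {x x' y : E} {D : ℝ}
    (h : ‖x - y‖ ≤ D) (h' : ‖x' - y‖ ≤ D) :
    ‖x - y‖ ^ 2 - ‖x' - y‖ ^ 2 ≤ 2 * D * ‖x - x'‖ := by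
  have h1 : ‖x - y‖ - ‖x' - y‖ ≤ ‖x - x'‖ := by
    refine (norm_sub_norm_le _ _).trans (le_of_eq ?_)
    congr 1; abel
  have h2 := mul_le_mul_of_nonneg_left h1 (add_nonneg (norm_nonneg (x - y)) (norm_nonneg (x' - y)))
  have h3 := mul_le_mul_of_nonneg_right (add_le_add h h') (norm_nonneg (x - x'))
  linarith

theorem sum_Icc_one_sub (D : ℕ → ℝ) (T : ℕ) :
    ∑ t ∈ Finset.Icc 1 T, (D t - D (t + 1)) = D 1 - D (T + 1) := by
  induction T with
  | zero => simp
  | succ T ih => rw [Finset.sum_Icc_succ_top (by omega), ih]; ring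

/-- Jensen's inequality in each row, then the column sums; a merely row-stochastic matrix would
reweight the agents. -/
theorem norm_mix_sub_sq_sum_le {n : ℕ} {E : Type*} [NormedAddCommGroup E]
    [InnerProductSpace ℝ E] {A : Matrix (Fin n) (Fin n) ℝ} (hA : ∀ i j, 0 ≤ A i j)
    (hrow : ∀ i, ∑ j, A i j = 1) (hcol : ∀ j, ∑ i, A i j = 1) (u : Fin n → E) (y : E) :
    ∑ i, ‖mix A u i - y‖ ^ 2 ≤ ∑ i, ‖u i - y‖ ^ 2 := by
  have hconv : ConvexOn ℝ Set.univ fun v : E => ‖v - y‖ ^ 2 := by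
    have h1 : ConvexOn ℝ Set.univ fun v : E => ‖v - y‖ := by
      simpa [dist_eq_norm] using convexOn_univ_dist y
    exact h1.pow (fun _ _ => norm_nonneg _) 2
  calc ∑ i, ‖mix A u i - y‖ ^ 2 ≤ ∑ i, ∑ j, A i j * ‖u j - y‖ ^ 2 :=
        Finset.sum_le_sum fun i _ =>
          hconv.map_sum_le (fun j _ => hA i j) (hrow i) fun _ _ => Set.mem_univ _
    _ = ∑ i, ‖u i - y‖ ^ 2 := by
        rw [Finset.sum_comm]
        simp only [← Finset.sum_mul, hcol, one_mul]

/-- The vector with all components equal to `s`. -/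
def constVec (s : ℝ) (r : ℕ) : Vec r := WithLp.toLp 2 fun _ => s

theorem norm_constVec_sq (s : ℝ) (r : ℕ) : ‖constVec s r‖ ^ 2 = r * s ^ 2 := by
  simp [constVec, EuclideanSpace.norm_sq_eq]

theorem norm_constVec_le {s : ℝ} (hs : 0 ≤ s) (r : ℕ) : ‖constVec s r‖ ≤ r * s := by
  refine (norm_le_sum_abs _).trans (le_of_eq ?_)
  simp [constVec, abs_of_nonneg hs]

theorem inner_constVec {r : ℕ} (v : Vec r) (s : ℝ) : inner ℝ v (constVec s r) = s * ∑ k, v k := by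
  simp [PiLp.inner_apply, constVec, Finset.mul_sum]

namespace Trajectory.IsGenerated

variable {n p : ℕ} {m : Fin n → ℕ} {S : Trajectory n p m} {P : Problem n p m} {N : Network n}
  {c : Params} {R F₁ F₂ w : ℝ} {B : ℕ}

theorem triggerError_one (hS : S.IsGenerated P N c F₂) : S.triggerError 1 = 0 := by
  simp [triggerError, hS.xhat_init]

theorem z_eq_mix (hS : S.IsGenerated P N c F₂) {t : ℕ} (ht : 1 ≤ t) :
    (fun i => S.z i (t + 1)) = mix (N.W t) fun i => S.xhat i t := by
  ext1 i; exact hS.z_step i t ht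

theorem norm_x_sub_x_succ_le (hS : S.IsGenerated P N c F₂) (hN : N.Regular w B) {t : ℕ}
    (ht : 1 ≤ t) (i : Fin n) : ‖S.x i t - S.x i (t + 1)‖ ≤
      ‖S.xhat i t - S.x i t‖ + S.disagreement t + ‖S.x i (t + 1) - S.z i (t + 1)‖ := by
  have h1 := norm_sub_mix_le (hN.nonneg ht) (hN.row_sum t ht) (fun i => S.xhat i t) i
  rw [← congrFun (hS.z_eq_mix ht) i] at h1
  have h : S.x i t - S.x i (t + 1) = - (S.xhat i t - S.x i t) + (S.xhat i t - S.z i (t + 1))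
      + - (S.x i (t + 1) - S.z i (t + 1)) := by abel
  rw [h, ← norm_neg (S.xhat i t - S.x i t), ← norm_neg (S.x i (t + 1) - S.z i (t + 1))]
  exact (norm_add_le _ _).trans
    (add_le_add_left ((norm_add_le _ _).trans (add_le_add_right h1 _)) _)

theorem sum_norm_z_sub_sq_le (hS : S.IsGenerated P N c F₂) (hN : N.Regular w B)
    (hP : P.Regular R F₁ F₂) {t : ℕ} (ht : 1 ≤ t) {y : Vec p} (hy : y ∈ P.X) :
    ∑ i, ‖S.z i (t + 1) - y‖ ^ 2 ≤ ∑ i, ‖S.x i t - y‖ ^ 2 + 4 * R * S.triggerError t := by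
  have h := norm_mix_sub_sq_sum_le (hN.nonneg ht) (hN.row_sum t ht) (hN.col_sum t ht)
    (fun i => S.xhat i t) y
  rw [← hS.z_eq_mix ht] at h
  refine h.trans ?_
  rw [triggerError, Finset.mul_sum, ← Finset.sum_add_distrib]
  refine Finset.sum_le_sum fun i _ => ?_
  have h1 := norm_sub_sq_sub_norm_sub_sq_le (hP.norm_sub_le (hS.xhat_mem i ht) hy)
    (hP.norm_sub_le (hS.x_mem i ht) hy)
  linarith

/-- The broadcast decisions are averaged and then perturbed by `xhat - z`, whose norm is at most a
trigger error plus a consensus step, so the general averaging estimate applies. -/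
theorem sum_disagreement_le (hS : S.IsGenerated P N c F₂) (hN : N.Regular w B) (hw : 0 < w)
    (hn : 1 ≤ n) (hR : 0 ≤ R) (hP : P.Regular R F₁ F₂) (T : ℕ) :
    ∑ t ∈ Finset.Icc 1 T, S.disagreement t ≤ (n * B) / (n * w ^ (n * B)) *
      (2 * R + 2 * (∑ t ∈ Finset.Icc 1 T, S.consensusStep (t + 1)
        + ∑ t ∈ Finset.Icc 1 T, S.triggerError t)) := by
  have h := hN.sum_spread_le hw hn (V₀ := 2 * R) (u := fun t i => S.xhat i t)
    (δ := fun t i => S.xhat i t - S.z i t) (fun t ht => by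
      rw [← hS.z_eq_mix ht]; ext1 i; simp)
    (fun t ht => spread_le (by linarith) fun i j =>
      hP.norm_sub_le (hS.xhat_mem i ht) (hS.xhat_mem j ht)) T
  refine h.trans (mul_le_mul_of_nonneg_left (add_le_add_right ?_ _) (by positivity))
  calc ∑ t ∈ Finset.Icc 2 T, spread (fun i => S.xhat i t - S.z i t)
      ≤ ∑ t ∈ Finset.Icc 2 T, 2 * (S.consensusStep t + S.triggerError t) := by
        refine Finset.sum_le_sum fun t _ => (spread_le_two_mul_sum_norm _).trans ?_
        rw [consensusStep, triggerError, ← Finset.sum_add_distrib]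
        gcongr with i
        rw [add_comm]
        exact norm_sub_le_norm_sub_add_norm_sub _ _ _
    _ = 2 * (∑ t ∈ Finset.Icc 2 T, S.consensusStep t
          + ∑ t ∈ Finset.Icc 2 T, S.triggerError t) := by
        rw [← Finset.mul_sum, Finset.sum_add_distrib]
    _ ≤ _ := by
        gcongr ?_ * (?_ + ?_)
        · have himg : ∑ t ∈ Finset.Icc 1 T, S.consensusStep (t + 1) =
              ∑ t ∈ (Finset.Icc 1 T).map (addRightEmbedding 1), S.consensusStep t := by
            rw [Finset.sum_map]; rfl
          rw [himg]
          refine Finset.sum_le_sum_of_subset_of_nonneg (fun t ht => ?_)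
            fun _ _ _ => S.consensusStep_nonneg _
          rw [Finset.mem_Icc] at ht
          exact Finset.mem_map.2 ⟨t - 1, Finset.mem_Icc.2 (by omega),
            by simp only [addRightEmbedding_apply]; omega⟩
        · exact Finset.sum_le_sum_of_subset_of_nonneg
            (Finset.Icc_subset_Icc_left (by norm_num)) fun _ _ _ => S.triggerError_nonneg _

section Power

variable {α₀ τ₀ θ₁ θ₂ θ₃ : ℝ}

/-- With every multiplier component equal to `s`, pairing with the clipped constraints gives exactly
`s` times the ℓ¹ violation. The movement is split along decision, broadcast, average, new decision.
-/
theorem network_step (hS : S.IsGenerated P N (powerParams α₀ τ₀ θ₁ θ₂ θ₃) F₂)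
    (hP : P.Regular R F₁ F₂) (hN : N.Regular w B) (hF₂ : 0 ≤ F₂) (hF : 0 ≤ F₁ + F₂ * (2 * R))
    (hθ₂ : 0 ≤ θ₂) (hα₀ : 0 < α₀)
    {t : ℕ} (ht : 1 ≤ t) {s : ℝ} (hs : 0 ≤ s)
    {y : Vec p} (hy : y ∈ P.X) (hg : ∀ i k, P.g i t y k ≤ 0) :
    ∑ i, (P.f i t (S.x i t) - P.f i t y) + s * S.localViolation P t ≤
      F₂ * (1 + (∑ i, (m i : ℝ)) * s) *
        (S.triggerError t + n * S.disagreement t + S.consensusStep (t + 1))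
        + ((t + 1 : ℕ) : ℝ) ^ θ₁ / (2 * α₀) *
          (∑ i, ‖S.x i t - y‖ ^ 2 - ∑ i, ‖S.x i (t + 1) - y‖ ^ 2)
        + ((t + 1 : ℕ) : ℝ) ^ θ₁ / (2 * α₀) * (4 * R * S.triggerError t)
        - ∑ i, ((t + 1 : ℕ) : ℝ) ^ θ₁ / (2 * α₀) * ‖S.x i (t + 1) - S.z i (t + 1)‖ ^ 2
        + ((t : ℝ) ^ (1 - θ₂) * (∑ i, ‖S.q i t - constVec s (m i)‖ ^ 2)
          - ((t + 1 : ℕ) : ℝ) ^ (1 - θ₂) * (∑ i, ‖S.q i (t + 1) - constVec s (m i)‖ ^ 2)) / 2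
        + (∑ i, (m i : ℝ)) * s ^ 2 / 2 * (1 / ((t + 1 : ℕ) : ℝ) ^ θ₂)
        + 2 * n * (F₁ + F₂ * (2 * R)) ^ 2 * (1 / ((t + 1 : ℕ) : ℝ) ^ (1 - θ₂)) := by
  set a := ((t + 1 : ℕ) : ℝ) ^ θ₁ / (2 * α₀) with ha
  have ha0 : 0 ≤ a := by positivity
  set M := ∑ i, (m i : ℝ) with hM
  have hstep : ∀ i, P.f i t (S.x i t) - P.f i t y + s * ∑ k, max (P.g i t (S.x i t) k) 0 ≤
      F₂ * (1 + M * s) * (‖S.xhat i t - S.x i t‖ + S.disagreement t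
          + ‖S.x i (t + 1) - S.z i (t + 1)‖)
        + (‖S.z i (t + 1) - y‖ ^ 2 - ‖S.x i (t + 1) - y‖ ^ 2
          - ‖S.x i (t + 1) - S.z i (t + 1)‖ ^ 2) * a
      + ((t : ℝ) ^ (1 - θ₂) * ‖S.q i t - constVec s (m i)‖ ^ 2
        - ((t + 1 : ℕ) : ℝ) ^ (1 - θ₂) * ‖S.q i (t + 1) - constVec s (m i)‖ ^ 2) / 2
      + 1 / ((t + 1 : ℕ) : ℝ) ^ θ₂ * (m i * s ^ 2) / 2
      + 2 * (F₁ + F₂ * (2 * R)) ^ 2 * (1 / ((t + 1 : ℕ) : ℝ) ^ (1 - θ₂)) := fun i => by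
    have h := hS.agent_step hP hF hθ₂ hα₀ i ht (μ := constVec s (m i)) (fun _ => hs) hy (hg i)
    rw [inner_constVec, norm_constVec_sq] at h
    simp only [orthantProj_apply] at h
    have h1 : (m i : ℝ) ≤ M :=
      Finset.single_le_sum (f := fun i => (m i : ℝ)) (fun _ _ => Nat.cast_nonneg _)
        (Finset.mem_univ i)
    have h2 := (norm_constVec_le hs (m i)).trans (mul_le_mul_of_nonneg_right h1 hs)
    have h3 := mul_le_mul (mul_le_mul_of_nonneg_left (add_le_add_right h2 1) hF₂)
      (hS.norm_x_sub_x_succ_le hN ht i) (norm_nonneg _) (by positivity)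
    linarith
  generalize 1 / ((t + 1 : ℕ) : ℝ) ^ θ₂ = b₁ at hstep ⊢
  generalize 1 / ((t + 1 : ℕ) : ℝ) ^ (1 - θ₂) = b₂ at hstep ⊢
  have hsum := Finset.sum_le_sum fun i (_ : i ∈ Finset.univ) => hstep i
  have hz := mul_le_mul_of_nonneg_left (hS.sum_norm_z_sub_sq_le hN hP ht hy) ha0
  simp only [Finset.sum_add_distrib, Finset.sum_sub_distrib, ← Finset.mul_sum, ← Finset.sum_mul,
    ← Finset.sum_div, Finset.sum_const, Finset.card_univ, Fintype.card_fin, nsmul_eq_mul] at hsum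
  simp only [localViolation, triggerError, consensusStep, Finset.sum_sub_distrib,
    ← Finset.mul_sum] at hz ⊢
  rw [← hM] at hsum
  linarith

theorem sum_network_le (hS : S.IsGenerated P N (powerParams α₀ τ₀ θ₁ θ₂ θ₃) F₂)
    (hP : P.Regular R F₁ F₂) (hN : N.Regular w B) (hR : 0 ≤ R) (hF₂ : 0 ≤ F₂)
    (hF : 0 ≤ F₁ + F₂ * (2 * R)) (hθ₁ : 0 ≤ θ₁) (hθ₂ : 0 < θ₂) (hθ₂' : θ₂ < 1) (hα₀ : 0 < α₀)
    {T : ℕ} (hT : 1 ≤ T) {s : ℝ} (hs : 0 ≤ s) {y : ℕ → Vec p} (hy : P.Feasible T y) :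
    ∑ t ∈ Finset.Icc 1 T, ∑ i, (P.f i t (S.x i t) - P.f i t (y t))
        + s * ∑ t ∈ Finset.Icc 1 T, S.localViolation P t ≤
      F₂ * (1 + (∑ i, (m i : ℝ)) * s) *
        (∑ t ∈ Finset.Icc 1 T, S.triggerError t + n * ∑ t ∈ Finset.Icc 1 T, S.disagreement t
          + ∑ t ∈ Finset.Icc 1 T, S.consensusStep (t + 1))
        + ((T + 1 : ℕ) : ℝ) ^ θ₁ / (2 * α₀) * (n * (4 * R ^ 2 + 4 * R * pathLength y T))
        + ∑ t ∈ Finset.Icc 1 T, ((t + 1 : ℕ) : ℝ) ^ θ₁ / (2 * α₀) * (4 * R * S.triggerError t)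
        - ∑ t ∈ Finset.Icc 1 T,
          ∑ i, ((t + 1 : ℕ) : ℝ) ^ θ₁ / (2 * α₀) * ‖S.x i (t + 1) - S.z i (t + 1)‖ ^ 2
        + (∑ i, (m i : ℝ)) * s ^ 2 / 2 * (1 + (T : ℝ) ^ (1 - θ₂) / (1 - θ₂))
        + 2 * n * (F₁ + F₂ * (2 * R)) ^ 2 * ((T : ℝ) ^ θ₂ / θ₂) := by
  set M := ∑ i, (m i : ℝ) with hM
  have hM0 : 0 ≤ M := Finset.sum_nonneg fun _ _ => Nat.cast_nonneg _
  set D : ℕ → ℝ := fun t => (t : ℝ) ^ (1 - θ₂) * ∑ i, ‖S.q i t - constVec s (m i)‖ ^ 2 with hD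
  set a : ℕ → ℝ := fun t => ((t + 1 : ℕ) : ℝ) ^ θ₁ / (2 * α₀) with ha
  set u : ℕ → ℝ := fun t => ∑ i, ‖S.x i t - y t‖ ^ 2 with hu
  set v : ℕ → ℝ := fun t => ∑ i, ‖S.x i (t + 1) - y t‖ ^ 2 with hv
  have hsum := Finset.sum_le_sum fun t (ht : t ∈ Finset.Icc 1 T) =>
    hS.network_step hP hN hF₂ hF hθ₂.le hα₀ (Finset.mem_Icc.1 ht).1 hs (hy t ht).1
      fun i k => (hy t ht).2 ⟨i, k⟩
  have htel : ∑ t ∈ Finset.Icc 1 T, a t * (u t - v t) ≤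
      a T * (n * (4 * R ^ 2 + 4 * R * pathLength y T)) := by
    have ha0 : ∀ t, 1 ≤ t → 0 ≤ a t := fun t _ => by simp only [ha]; positivity
    have hsq : ∀ t ∈ Finset.Icc 1 T, ∀ r, 1 ≤ r → ∑ i, ‖S.x i r - y t‖ ^ 2 ≤ n * (4 * R ^ 2) := by
      intro t ht r hr
      have : ∀ i ∈ Finset.univ, ‖S.x i r - y t‖ ^ 2 ≤ 4 * R ^ 2 := fun i _ => by
        have := pow_le_pow_left₀ (norm_nonneg _)
          (hP.norm_sub_le (hS.x_mem i hr) (hy t ht).1) 2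
        linarith
      simpa using Finset.sum_le_sum this
    have h := sum_mul_sub_le_of_monotone (a := a) (u := u) (v := v)
      (d := fun t => n * (4 * R * ‖y (t + 1) - y t‖)) (M := n * (4 * R ^ 2)) ha0
      (fun t _ => by
        simp only [ha]
        gcongr
        simp) hT
      (fun t ht => hsq t ht t (Finset.mem_Icc.1 ht).1)
      (fun t ht => hsq t ht (t + 1) (by omega))
      (fun t ht => by
        rw [Finset.mem_Ico] at ht
        have : ∀ i ∈ Finset.univ, ‖S.x i (t + 1) - y (t + 1)‖ ^ 2 ≤
            ‖S.x i (t + 1) - y t‖ ^ 2 + 4 * R * ‖y (t + 1) - y t‖ := fun i _ => by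
          have hx := hS.x_mem i (show 1 ≤ t + 1 by omega)
          have h1 := norm_sub_sq_sub_norm_sub_sq_le
            (hP.norm_sub_le (hy (t + 1) (by simp; omega)).1 hx)
            (hP.norm_sub_le (hy t (by simp; omega)).1 hx)
          rw [norm_sub_rev _ (S.x i (t + 1)), norm_sub_rev _ (S.x i (t + 1))] at h1
          linarith
        simpa [Finset.sum_add_distrib] using Finset.sum_le_sum this)
    have hv0 : 0 ≤ a T * v T :=
      mul_nonneg (ha0 T hT) (Finset.sum_nonneg fun _ _ => sq_nonneg _)
    have hpl : ∑ t ∈ Finset.Ico 1 T, |(n : ℝ) * (4 * R * ‖y (t + 1) - y t‖)| =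
        n * (4 * R * pathLength y T) := by
      rw [pathLength, Finset.mul_sum, Finset.mul_sum]
      exact Finset.sum_congr rfl fun t _ => abs_of_nonneg (by positivity)
    rw [hpl] at h
    linarith
  -- The dual variables start at zero with weight one, so only the squared norms of the multipliers
  -- remain; this is the summand `1` next to the power of `T`.
  have hdual : ∑ t ∈ Finset.Icc 1 T, (D t - D (t + 1)) / 2 ≤ M * s ^ 2 / 2 := by
    have hD1 : D 1 = M * s ^ 2 := by
      simp [hD, hS.q_init, norm_constVec_sq, hM, Finset.sum_mul]
    have hDT : 0 ≤ D (T + 1) := by simp only [hD]; positivity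
    rw [← Finset.sum_div, sum_Icc_one_sub, hD1]
    linarith
  have hβ := mul_le_mul_of_nonneg_left (sum_Icc_rpow_neg_succ_le hθ₂.le hθ₂' T)
    (show 0 ≤ M * s ^ 2 / 2 by positivity)
  have hγ := mul_le_mul_of_nonneg_left
    (sum_Icc_rpow_neg_succ_le (s := 1 - θ₂) (by linarith) (by linarith) T)
    (show 0 ≤ 2 * n * (F₁ + F₂ * (2 * R)) ^ 2 by positivity)
  rw [sub_sub_cancel] at hγ
  simp only [Finset.sum_add_distrib, Finset.sum_sub_distrib, ← Finset.mul_sum] at hsum hdual htel ⊢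
  simp only [hD, ha, hu, hv] at hsum hdual htel ⊢
  linarith

end Power

end Trajectory.IsGenerated

/-! ### Passing from local quantities to network regret and violation. -/

namespace Trajectory.IsGenerated

section Comparison

variable {n p : ℕ} {m : Fin n → ℕ} {S : Trajectory n p m} {P : Problem n p m} {N : Network n}
  {c : Params} {R F₁ F₂ : ℝ}

theorem sum_globalLoss_le (hS : S.IsGenerated P N c F₂) (hP : P.Regular R F₁ F₂) (hF₂ : 0 ≤ F₂)
    (hn : 1 ≤ n) {t : ℕ} (ht : 1 ≤ t) :
    ∑ i, P.globalLoss t (S.x i t) ≤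
      ∑ j, P.f j t (S.x j t) + F₂ * (n * S.disagreement t + 2 * S.triggerError t) := by
  have hn' : (0 : ℝ) < n := by exact_mod_cast hn
  have h : ∀ i j, P.f j t (S.x i t) ≤ P.f j t (S.x j t) + F₂ * (S.disagreement t
      + ‖S.xhat i t - S.x i t‖ + ‖S.xhat j t - S.x j t‖) := fun i j => by
    have h1 := hP.loss_sub_le (i := j) ht (hS.x_mem i ht) (hS.x_mem j ht)
    have h2 := mul_le_mul_of_nonneg_left (S.norm_x_sub_x_le t i j) hF₂
    linarith
  have hsum := Finset.sum_le_sum fun i (_ : i ∈ Finset.univ) =>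
    Finset.sum_le_sum fun j (_ : j ∈ Finset.univ) => h i j
  simp only [Finset.sum_add_distrib, ← Finset.mul_sum, Finset.sum_const, Finset.card_univ,
    Fintype.card_fin, nsmul_eq_mul] at hsum
  simp only [Problem.globalLoss, ← Finset.mul_sum, triggerError]
  rw [one_div, inv_mul_le_iff₀ hn']
  linarith

theorem mul_netRegret_le (hS : S.IsGenerated P N c F₂) (hP : P.Regular R F₁ F₂) (hF₂ : 0 ≤ F₂)
    (hn : 1 ≤ n) (T : ℕ) (y : ℕ → Vec p) :
    n * P.netRegret S.x T y ≤ ∑ t ∈ Finset.Icc 1 T, ∑ i, (P.f i t (S.x i t) - P.f i t (y t))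
      + F₂ * (n * ∑ t ∈ Finset.Icc 1 T, S.disagreement t
        + 2 * ∑ t ∈ Finset.Icc 1 T, S.triggerError t) := by
  have hn' : (n : ℝ) ≠ 0 := by exact_mod_cast (show n ≠ 0 by omega)
  have h := Finset.sum_le_sum fun t (ht : t ∈ Finset.Icc 1 T) =>
    hS.sum_globalLoss_le hP hF₂ hn (Finset.mem_Icc.1 ht).1
  have h1 : n * P.netRegret S.x T y = ∑ t ∈ Finset.Icc 1 T, ∑ i, P.globalLoss t (S.x i t)
      - ∑ t ∈ Finset.Icc 1 T, ∑ i, P.f i t (y t) := by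
    rw [Problem.netRegret, mul_sub, ← mul_assoc, mul_one_div_cancel hn', one_mul,
      Finset.sum_comm (s := Finset.univ)]
    congr 1
    rw [Finset.mul_sum]
    refine Finset.sum_congr rfl fun t _ => ?_
    rw [Problem.globalLoss, ← mul_assoc, mul_one_div_cancel hn', one_mul]
  rw [h1]
  simp only [Finset.sum_add_distrib, Finset.sum_sub_distrib, ← Finset.mul_sum] at h ⊢
  linarith

/-- Each agent is charged for all constraints, whereas the algorithm controls constraint `j` only at
agent `j`; Lipschitz continuity transfers between the two at the cost of their distance. -/
theorem norm_globalConstraint_le (hS : S.IsGenerated P N c F₂) (hP : P.Regular R F₁ F₂)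
    (hF₂ : 0 ≤ F₂) {t : ℕ} (ht : 1 ≤ t) (i : Fin n) :
    ‖orthantProj (P.globalConstraint t (S.x i t))‖ ≤ S.localViolation P t
      + 2 * F₂ * (∑ j, (m j : ℝ)) * (S.disagreement t + S.triggerError t) := by
  have hE : ∀ j, ‖S.xhat j t - S.x j t‖ ≤ S.triggerError t := fun j =>
    Finset.single_le_sum (f := fun j => ‖S.xhat j t - S.x j t‖) (fun _ _ => norm_nonneg _)
      (Finset.mem_univ j)
  calc ‖orthantProj (P.globalConstraint t (S.x i t))‖
      ≤ ∑ j, ∑ k, max (P.g j t (S.x i t) k) 0 := by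
        refine (norm_le_sum_abs _).trans (le_of_eq ?_)
        rw [Fintype.sum_sigma]
        refine Finset.sum_congr rfl fun j _ => Finset.sum_congr rfl fun k _ => ?_
        rw [orthantProj_apply, abs_of_nonneg (le_max_right _ _)]
        rfl
    _ ≤ ∑ j, ∑ k, (max (P.g j t (S.x j t) k) 0
          + F₂ * (2 * (S.disagreement t + S.triggerError t))) := by
        refine Finset.sum_le_sum fun j _ => Finset.sum_le_sum fun k _ => ?_
        have h1 := hP.max_constraint_le ht (hS.x_mem i ht) (hS.x_mem j ht) k
        refine h1.trans (add_le_add_right (mul_le_mul_of_nonneg_left ?_ hF₂) _)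
        linarith [S.norm_x_sub_x_le t i j, hE i, hE j, S.disagreement_nonneg t]
    _ = _ := by
        simp only [Finset.sum_add_distrib, Finset.sum_const, Finset.card_univ, Fintype.card_fin,
          nsmul_eq_mul, ← Finset.sum_mul, localViolation]
        ring

theorem netCCV_le (hS : S.IsGenerated P N c F₂) (hP : P.Regular R F₁ F₂) (hF₂ : 0 ≤ F₂)
    (hn : 1 ≤ n) (T : ℕ) :
    P.netCCV S.x T ≤ ∑ t ∈ Finset.Icc 1 T, S.localViolation P t
      + 2 * F₂ * (∑ j, (m j : ℝ)) * (∑ t ∈ Finset.Icc 1 T, S.triggerError t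
        + ∑ t ∈ Finset.Icc 1 T, S.disagreement t) := by
  have hn' : (0 : ℝ) < n := by exact_mod_cast hn
  have h := Finset.sum_le_sum fun i (_ : i ∈ Finset.univ) =>
    Finset.sum_le_sum fun t (ht : t ∈ Finset.Icc 1 T) =>
      hS.norm_globalConstraint_le hP hF₂ (Finset.mem_Icc.1 ht).1 i
  rw [Problem.netCCV, one_div, inv_mul_le_iff₀ hn']
  refine h.trans (le_of_eq ?_)
  simp only [Finset.sum_add_distrib, ← Finset.mul_sum, Finset.sum_const, Finset.card_univ,
    Fintype.card_fin, nsmul_eq_mul]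
  ring

theorem netCCV_le_trivial (hS : S.IsGenerated P N c F₂) (hP : P.Regular R F₁ F₂) (hF₁ : 0 ≤ F₁)
    (hn : 1 ≤ n) (T : ℕ) : P.netCCV S.x T ≤ n * F₁ * T := by
  have hn' : (1 : ℝ) ≤ n := by exact_mod_cast hn
  have h : ∀ i, ∀ t ∈ Finset.Icc 1 T,
      ‖orthantProj (P.globalConstraint t (S.x i t))‖ ≤ n * F₁ := fun i t ht => by
    have ht := (Finset.mem_Icc.1 ht).1
    refine (norm_orthantProj_le _).trans ?_
    refine abs_le_of_sq_le_sq' ?_ (by positivity) |>.2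
    have h1 : ‖P.globalConstraint t (S.x i t)‖ ^ 2 = ∑ j, ‖P.g j t (S.x i t)‖ ^ 2 := by
      simp only [EuclideanSpace.norm_sq_eq]
      rw [Fintype.sum_sigma]
      rfl
    have h2 : ∀ j ∈ Finset.univ, ‖P.g j t (S.x i t)‖ ^ 2 ≤ F₁ ^ 2 := fun j _ =>
      pow_le_pow_left₀ (norm_nonneg _) (hP.constraint_bound j t ht _ (hS.x_mem i ht)) 2
    rw [h1]
    refine (Finset.sum_le_sum h2).trans ?_
    simp only [Finset.sum_const, Finset.card_univ, Fintype.card_fin, nsmul_eq_mul]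
    rw [mul_pow]
    exact mul_le_mul_of_nonneg_right (by nlinarith) (sq_nonneg _)
  have hsum := Finset.sum_le_sum fun i (_ : i ∈ Finset.univ) => Finset.sum_le_sum (h i)
  rw [Problem.netCCV, one_div, inv_mul_le_iff₀ (by linarith)]
  refine hsum.trans (le_of_eq ?_)
  simp only [Finset.sum_const, Finset.card_univ, Fintype.card_fin, nsmul_eq_mul, Nat.card_Icc,
    add_tsub_cancel_right]
  ring

theorem neg_mul_le_sum_loss (hS : S.IsGenerated P N c F₂) (hP : P.Regular R F₁ F₂) {T : ℕ}
    {y : ℕ → Vec p} (hy : P.Feasible T y) :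
    - (n * F₁ * T) ≤ ∑ t ∈ Finset.Icc 1 T, ∑ i, (P.f i t (S.x i t) - P.f i t (y t)) := by
  have h : ∀ t ∈ Finset.Icc 1 T, ∀ i ∈ Finset.univ,
      -F₁ ≤ P.f i t (S.x i t) - P.f i t (y t) := fun t ht i _ => by
    have ht1 := (Finset.mem_Icc.1 ht).1
    exact (abs_le.1 (hP.loss_bound i t ht1 _ (hS.x_mem i ht1) _ (hy t ht).1)).1
  refine le_trans (le_of_eq ?_) (Finset.sum_le_sum fun t ht => Finset.sum_le_sum (h t ht))
  simp
  ring

theorem triggerError_le (hS : S.IsGenerated P N c F₂) (hP : P.Regular R F₁ F₂) {t : ℕ}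
    (ht : 2 ≤ t) (hτ : 0 ≤ c.τ t) : S.triggerError t ≤ n * min (2 * R) (c.τ t) := by
  have h : ∀ i ∈ Finset.univ, ‖S.xhat i t - S.x i t‖ ≤ min (2 * R) (c.τ t) := fun i _ =>
    le_min (hP.norm_sub_le (hS.xhat_mem i (by omega)) (hS.x_mem i (by omega)))
      (hS.norm_xhat_sub_x_le i ht hτ)
  simpa [triggerError] using Finset.sum_le_sum h

/-- Initial decisions are broadcast exactly, so sums may start at `2`. This permits the bound `log
T` with no additive constant, even at `T = 1`. -/
theorem sum_Icc_one_mul_triggerError (hS : S.IsGenerated P N c F₂) {T : ℕ} (hT : 1 ≤ T)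
    (a : ℕ → ℝ) : ∑ t ∈ Finset.Icc 1 T, a t * S.triggerError t =
      ∑ t ∈ Finset.Icc 2 T, a t * S.triggerError t := by
  rw [← Finset.add_sum_Ioc_eq_sum_Icc hT, hS.triggerError_one, mul_zero, zero_add]
  rfl

end Comparison

end Trajectory.IsGenerated

/-! ### The combined bound with instance-independent constants. -/

theorem mul_sub_mul_sq_le {a r x : ℝ} (ha : 0 < a) : r * x - a * x ^ 2 ≤ r ^ 2 / (4 * a) := by
  rw [le_div_iff₀ (by positivity)]
  nlinarith [sq_nonneg (r - 2 * a * x)]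

theorem succ_rpow_div_le {α θ : ℝ} (hα : 0 < α) (h₀ : 0 ≤ θ) (h₁ : θ ≤ 1) {t : ℕ} (ht : 1 ≤ t) :
    ((t + 1 : ℕ) : ℝ) ^ θ / (2 * α) ≤ (t : ℝ) ^ θ / α := by
  rw [div_le_div_iff₀ (by positivity) hα]
  have := mul_le_mul_of_nonneg_right (rpow_succ_le_two_mul h₀ h₁ ht) hα.le
  linarith

theorem sum_mul_le_sum_mul_sum {a₁ a₂ a₃ a₄ a₅ a₆ x₁ x₂ x₃ x₄ x₅ x₆ : ℝ}
    (ha₁ : 0 ≤ a₁) (ha₂ : 0 ≤ a₂) (ha₃ : 0 ≤ a₃) (ha₄ : 0 ≤ a₄) (ha₅ : 0 ≤ a₅) (ha₆ : 0 ≤ a₆)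
    (hx₁ : 0 ≤ x₁) (hx₂ : 0 ≤ x₂) (hx₃ : 0 ≤ x₃) (hx₄ : 0 ≤ x₄) (hx₅ : 0 ≤ x₅) (hx₆ : 0 ≤ x₆) :
    a₁ * x₁ + a₂ * x₂ + a₃ * x₃ + a₄ * x₄ + a₅ * x₅ + a₆ * x₆ ≤
      (a₁ + a₂ + a₃ + a₄ + a₅ + a₆ + 1) * (x₁ + x₂ + x₃ + x₄ + x₅ + x₆) := by
  have e : (a₁ + a₂ + a₃ + a₄ + a₅ + a₆ + 1) * (x₁ + x₂ + x₃ + x₄ + x₅ + x₆) =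
      a₁ * x₁ + a₂ * x₂ + a₃ * x₃ + a₄ * x₄ + a₅ * x₅ + a₆ * x₆
      + (a₁ * (x₂ + x₃ + x₄ + x₅ + x₆) + a₂ * (x₁ + x₃ + x₄ + x₅ + x₆)
        + a₃ * (x₁ + x₂ + x₄ + x₅ + x₆) + a₄ * (x₁ + x₂ + x₃ + x₅ + x₆)
        + a₅ * (x₁ + x₂ + x₃ + x₄ + x₆) + a₆ * (x₁ + x₂ + x₃ + x₄ + x₅)
        + (x₁ + x₂ + x₃ + x₄ + x₅ + x₆)) := by ring
  rw [e]
  exact le_add_of_nonneg_right (by positivity)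

set_option maxHeartbeats 1000000 in
/-- The combined bound on loss differences, weighted violations and disagreement, with a
constant that does not depend on the problem instance, the step sizes or the thresholds. -/
theorem exists_combined_bound (n : ℕ) (hn : 1 ≤ n) (m : Fin n → ℕ) {R F₁ F₂ w : ℝ} (B : ℕ)
    (hR : 0 ≤ R) (hF₁ : 0 ≤ F₁) (hF₂ : 0 ≤ F₂) (hw : 0 < w)
    {θ₁ θ₂ : ℝ} (θ₃ : ℝ) (hθ₁ : 0 ≤ θ₁) (hθ₁' : θ₁ < 1) (hθ₂ : 0 < θ₂) (hθ₂' : θ₂ < 1)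
    {κ : ℝ} (hκ : 0 ≤ κ) :
    ∃ C : ℝ, 0 < C ∧ ∀ (p : ℕ) (P : Problem n p m) (N : Network n) (S : Trajectory n p m)
      (α₀ τ₀ : ℝ), 0 < α₀ → P.Regular R F₁ F₂ → N.Regular w B →
      S.IsGenerated P N (powerParams α₀ τ₀ θ₁ θ₂ θ₃) F₂ →
      ∀ (T : ℕ), 1 ≤ T → ∀ y : ℕ → Vec p, P.Feasible T y → ∀ s : ℝ, 0 ≤ s →
      ∑ t ∈ Finset.Icc 1 T, ∑ i, (P.f i t (S.x i t) - P.f i t (y t))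
        + s * ∑ t ∈ Finset.Icc 1 T, S.localViolation P t
        + κ * (1 + s) * (∑ t ∈ Finset.Icc 1 T, S.triggerError t
          + ∑ t ∈ Finset.Icc 1 T, S.disagreement t) ≤
      C * ((1 + s) ^ 2 * (α₀ * (T : ℝ) ^ (1 - θ₁))
        + (1 + s) * (1 + ∑ t ∈ Finset.Icc 1 T, S.triggerError t)
        + s ^ 2 * (T : ℝ) ^ (1 - θ₂) + (T : ℝ) ^ θ₂ + (T : ℝ) ^ θ₁ * (1 + pathLength y T) / α₀
        + ∑ t ∈ Finset.Icc 1 T, (t : ℝ) ^ θ₁ / α₀ * S.triggerError t) := by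
  have hn' : (1 : ℝ) ≤ n := by exact_mod_cast hn
  have h1θ₁ : 0 < 1 - θ₁ := by linarith
  have h1θ₂ : 0 < 1 - θ₂ := by linarith
  set M := ∑ i, (m i : ℝ) with hM
  have hM0 : 0 ≤ M := Finset.sum_nonneg fun _ _ => Nat.cast_nonneg _
  set K : ℝ := (n * B) / (n * w ^ (n * B)) with hK
  have hK0 : 0 ≤ K := by positivity
  set F := F₁ + F₂ * (2 * R) with hF
  have hF0 : 0 ≤ F := by positivity
  set c₁ := κ + n * (F₂ * (1 + M)) with hc₁
  have hc₁0 : 0 ≤ c₁ := by positivity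
  set c₂ := c₁ * (1 + 2 * K + 2 * K * R) with hc₂
  have hc₂0 : 0 ≤ c₂ := by positivity
  set k₁ := n * c₂ ^ 2 / (2 * (1 - θ₁)) with hk₁
  set k₂ := n * (4 * R ^ 2 + 4 * R) with hk₂
  set k₃ := M / 2 * (1 + 1 / (1 - θ₂)) with hk₃
  set k₄ := 2 * n * F ^ 2 / θ₂ with hk₄
  have hk₁0 : 0 ≤ k₁ := by positivity
  have hk₂0 : 0 ≤ k₂ := by positivity
  have hk₃0 : 0 ≤ k₃ := by positivity
  have hk₄0 : 0 ≤ k₄ := by positivity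
  refine ⟨k₁ + c₂ + k₃ + k₄ + k₂ + 4 * R + 1, by positivity, ?_⟩
  intro p P N S α₀ τ₀ hα₀ hP hN hS T hT y hy s hs
  have hT1 : (1 : ℝ) ≤ T := by exact_mod_cast hT
  have hnet := hS.sum_network_le hP hN hR hF₂ hF0 hθ₁ hθ₂ hθ₂' hα₀ hT hs hy
  have hdis := hS.sum_disagreement_le hN hw hn hR hP T
  rw [← hM, ← hF] at hnet
  rw [← hK] at hdis
  set SE := ∑ t ∈ Finset.Icc 1 T, S.triggerError t with hSE
  set SV := ∑ t ∈ Finset.Icc 1 T, S.disagreement t with hSV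
  set SH := ∑ t ∈ Finset.Icc 1 T, S.consensusStep (t + 1) with hSH
  set Q := ∑ t ∈ Finset.Icc 1 T,
    ∑ i, ((t + 1 : ℕ) : ℝ) ^ θ₁ / (2 * α₀) * ‖S.x i (t + 1) - S.z i (t + 1)‖ ^ 2 with hQ
  have hSE0 : 0 ≤ SE := Finset.sum_nonneg fun _ _ => S.triggerError_nonneg _
  have hSV0 : 0 ≤ SV := Finset.sum_nonneg fun _ _ => S.disagreement_nonneg _
  have hSH0 : 0 ≤ SH := Finset.sum_nonneg fun _ _ => S.consensusStep_nonneg _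
  have hPL : 0 ≤ pathLength y T := Finset.sum_nonneg fun _ _ => norm_nonneg _
  -- Disagreement is eliminated in favour of trigger errors and consensus steps; the term with `κ`
  -- reserves room for the later conversions to regret and violation.
  have hA : F₂ * (1 + M * s) * (SE + n * SV + SH) + κ * (1 + s) * (SE + SV) ≤
      c₂ * (1 + s) * (1 + SE + SH) := by
    have h1 : F₂ * (1 + M * s) ≤ F₂ * (1 + M) * (1 + s) := by
      rw [mul_assoc]; exact mul_le_mul_of_nonneg_left (by linarith [mul_nonneg hM0 hs]) hF₂
    have h2 : SE + n * SV + SH ≤ n * (SE + SV + SH) := by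
      linarith [mul_nonneg (sub_nonneg.2 hn') hSE0, mul_nonneg (sub_nonneg.2 hn') hSH0]
    have h3 := mul_le_mul h1 h2 (by positivity) (by positivity)
    have h4 : κ * (1 + s) * (SE + SV) ≤ κ * (1 + s) * (SE + SV + SH) :=
      mul_le_mul_of_nonneg_left (by linarith) (by positivity)
    have h5 : SE + SV + SH ≤ (1 + 2 * K + 2 * K * R) * (1 + SE + SH) := by
      have : 0 ≤ K * R * (SE + SH) := by positivity
      linarith
    have h6 := mul_le_mul_of_nonneg_left h5 (show 0 ≤ c₁ * (1 + s) by positivity)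
    have h7 : c₁ * (1 + s) * (SE + SV + SH) =
        κ * (1 + s) * (SE + SV + SH) + F₂ * (1 + M) * (1 + s) * (n * (SE + SV + SH)) := by
      rw [hc₁]; ring
    have h8 : c₁ * (1 + s) * ((1 + 2 * K + 2 * K * R) * (1 + SE + SH)) =
        c₂ * (1 + s) * (1 + SE + SH) := by
      rw [hc₂]; ring
    linarith
  -- Each linear consensus term is dominated by completing the square against the matching term of
  -- `Q`; the quotient is proportional to the step size of that round.
  have hB : c₂ * (1 + s) * SH - Q ≤ k₁ * ((1 + s) ^ 2 * (α₀ * (T : ℝ) ^ (1 - θ₁))) := by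
    have hterm : ∀ t ∈ Finset.Icc 1 T, c₂ * (1 + s) * S.consensusStep (t + 1)
        - ∑ i, ((t + 1 : ℕ) : ℝ) ^ θ₁ / (2 * α₀) * ‖S.x i (t + 1) - S.z i (t + 1)‖ ^ 2 ≤
        n * (c₂ * (1 + s)) ^ 2 * α₀ / 2 * (1 / ((t + 1 : ℕ) : ℝ) ^ θ₁) := fun t _ => by
      have hp : 0 < ((t + 1 : ℕ) : ℝ) ^ θ₁ := Real.rpow_pos_of_pos (by positivity) _
      rw [Trajectory.consensusStep, Finset.mul_sum, ← Finset.sum_sub_distrib]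
      refine (Finset.sum_le_sum fun i _ => mul_sub_mul_sq_le (by positivity)).trans (le_of_eq ?_)
      simp only [Finset.sum_const, Finset.card_univ, Fintype.card_fin, nsmul_eq_mul]
      field_simp
      ring
    have h := Finset.sum_le_sum hterm
    rw [Finset.sum_sub_distrib, ← Finset.mul_sum, ← Finset.mul_sum] at h
    refine h.trans ((mul_le_mul_of_nonneg_left (sum_Icc_rpow_neg_succ_le hθ₁ hθ₁' T)
      (by positivity)).trans (le_of_eq ?_))
    rw [hk₁]
    field_simp
  have hC : ((T + 1 : ℕ) : ℝ) ^ θ₁ / (2 * α₀) * (n * (4 * R ^ 2 + 4 * R * pathLength y T)) ≤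
      k₂ * ((T : ℝ) ^ θ₁ * (1 + pathLength y T) / α₀) := by
    have h2 : n * (4 * R ^ 2 + 4 * R * pathLength y T) ≤ k₂ * (1 + pathLength y T) := by
      have h3 : 0 ≤ n * (4 * R ^ 2 * pathLength y T + 4 * R) := by positivity
      rw [hk₂]
      linarith
    refine (mul_le_mul (succ_rpow_div_le hα₀ hθ₁ hθ₁'.le hT) h2 (by positivity)
      (by positivity)).trans (le_of_eq ?_)
    ring
  have hD : ∑ t ∈ Finset.Icc 1 T, ((t + 1 : ℕ) : ℝ) ^ θ₁ / (2 * α₀) * (4 * R * S.triggerError t) ≤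
      4 * R * ∑ t ∈ Finset.Icc 1 T, (t : ℝ) ^ θ₁ / α₀ * S.triggerError t := by
    rw [Finset.mul_sum]
    refine Finset.sum_le_sum fun t ht => ?_
    refine (mul_le_mul_of_nonneg_right (succ_rpow_div_le hα₀ hθ₁ hθ₁'.le (Finset.mem_Icc.1 ht).1)
      (mul_nonneg (by positivity) (S.triggerError_nonneg t))).trans (le_of_eq ?_)
    ring
  have hE : M * s ^ 2 / 2 * (1 + (T : ℝ) ^ (1 - θ₂) / (1 - θ₂)) ≤
      k₃ * (s ^ 2 * (T : ℝ) ^ (1 - θ₂)) := by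
    have h1 : (1 : ℝ) ≤ (T : ℝ) ^ (1 - θ₂) := Real.one_le_rpow hT1 h1θ₂.le
    have h2 : 1 + (T : ℝ) ^ (1 - θ₂) / (1 - θ₂) ≤
        (1 + 1 / (1 - θ₂)) * (T : ℝ) ^ (1 - θ₂) := by
      rw [add_mul, one_mul, one_div_mul_eq_div]; linarith
    refine (mul_le_mul_of_nonneg_left h2 (by positivity)).trans (le_of_eq ?_)
    rw [hk₃]; ring
  have hG : 2 * n * F ^ 2 * ((T : ℝ) ^ θ₂ / θ₂) = k₄ * (T : ℝ) ^ θ₂ := by rw [hk₄]; ring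
  have hX₁ : 0 ≤ (1 + s) ^ 2 * (α₀ * (T : ℝ) ^ (1 - θ₁)) := by positivity
  have hX₂ : 0 ≤ (1 + s) * (1 + SE) := by positivity
  have hX₃ : 0 ≤ s ^ 2 * (T : ℝ) ^ (1 - θ₂) := by positivity
  have hX₄ : 0 ≤ (T : ℝ) ^ θ₂ := by positivity
  have hX₅ : 0 ≤ (T : ℝ) ^ θ₁ * (1 + pathLength y T) / α₀ := by positivity
  have hX₆ : 0 ≤ ∑ t ∈ Finset.Icc 1 T, (t : ℝ) ^ θ₁ / α₀ * S.triggerError t :=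
    Finset.sum_nonneg fun t _ => mul_nonneg (by positivity) (S.triggerError_nonneg t)
  have hc₂k : c₂ * (1 + s) * (1 + SE + SH) = c₂ * ((1 + s) * (1 + SE)) + c₂ * (1 + s) * SH := by
    ring
  have hfin := sum_mul_le_sum_mul_sum hk₁0 hc₂0 hk₃0 hk₄0 hk₂0 (show 0 ≤ 4 * R by positivity)
    hX₁ hX₂ hX₃ hX₄ hX₅ hX₆
  linarith

/-! ### Uniform regret and violation bounds. -/

/-- With `α` the step size, this trades a trigger error for two terms already present in the regret
bound, so no constant depends on `α₀` or `τ₀`. -/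
theorem min_le_mul_add_div {D τ α : ℝ} (hD : 0 ≤ D) (hτ : 0 ≤ τ) (hα : 0 < α) :
    min D τ ≤ D * α + τ / α := by
  rcases le_total 1 α with h | h
  · have h1 : D ≤ D * α := le_mul_of_one_le_right hD h
    have h2 : 0 ≤ τ / α := by positivity
    linarith [min_le_left D τ]
  · have h1 : τ ≤ τ / α := le_div_self hτ hα h
    have h2 : 0 ≤ D * α := by positivity
    linarith [min_le_right D τ]

/-- For small `s` the diameter cap suffices, for large `s` one has `s ≤ s ^ 2`. The result has the
form constant plus `s ^ 2` times something, as needed for optimizing `s`. -/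
theorem mul_min_le {D τ s : ℝ} (hD : 0 ≤ D) (hτ : 0 ≤ τ) (hs : 0 ≤ s) :
    s * min D τ ≤ s ^ 2 * τ + D := by
  rcases le_total s 1 with h | h
  · have h1 := mul_le_mul_of_nonneg_left (min_le_left D τ) hs
    have h2 : s * D ≤ D := mul_le_of_le_one_left hD h
    have h3 : 0 ≤ s ^ 2 * τ := by positivity
    linarith
  · have h1 := mul_le_mul_of_nonneg_left (min_le_right D τ) hs
    have h2 : s * τ ≤ s ^ 2 * τ := mul_le_mul_of_nonneg_right (by nlinarith) hτ
    linarith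

theorem le_two_mul_sqrt_of_forall_mul_le {C X T A : ℝ} (hT : 0 < T) (hA : 0 < A)
    (h : ∀ s, 0 ≤ s → s * X ≤ C * (T + s ^ 2 * A)) : X ≤ 2 * C * √(T * A) := by
  have h1 := h (√(T / A)) (Real.sqrt_nonneg _)
  rw [Real.sq_sqrt (by positivity), div_mul_cancel₀ _ hA.ne'] at h1
  have h2 : √(T / A) * √(T * A) = T := by
    rw [← Real.sqrt_mul (by positivity), show T / A * (T * A) = T ^ 2 by field_simp,
      Real.sqrt_sq hT.le]
  have h3 : 0 < √(T / A) := Real.sqrt_pos.2 (by positivity)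
  refine le_of_mul_le_mul_left ?_ h3
  calc √(T / A) * X ≤ C * (T + T) := h1
    _ = 2 * C * (√(T / A) * √(T * A)) := by rw [h2]; ring
    _ = √(T / A) * (2 * C * √(T * A)) := by ring

theorem sqrt_mul_rpow_one_sub {T : ℝ} (hT : 0 < T) (θ : ℝ) :
    √(T * T ^ (1 - θ)) = T ^ (1 - θ / 2) := by
  have h : T * T ^ (1 - θ) = T ^ (2 - θ) := by
    rw [show 2 - θ = 1 + (1 - θ) by ring, Real.rpow_add hT, Real.rpow_one]
  rw [h, Real.sqrt_eq_rpow, ← Real.rpow_mul hT.le]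
  congr 1; ring

theorem sqrt_add_le {x y : ℝ} (hx : 0 ≤ x) (hy : 0 ≤ y) : √(x + y) ≤ √x + √y := by
  rw [Real.sqrt_le_iff]
  refine ⟨by positivity, ?_⟩
  rw [add_sq, Real.sq_sqrt hx, Real.sq_sqrt hy]
  have : 0 ≤ 2 * √x * √y := by positivity
  linarith

theorem sum_rpow_div_mul_triggerError_le {n p : ℕ} {m : Fin n → ℕ} {S : Trajectory n p m}
    {P : Problem n p m} {N : Network n} {R F₁ F₂ α₀ τ₀ θ₁ θ₂ θ₃ : ℝ}
    (hS : S.IsGenerated P N (powerParams α₀ τ₀ θ₁ θ₂ θ₃) F₂) (hP : P.Regular R F₁ F₂)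
    (hα₀ : 0 < α₀) (hτ₀ : 0 ≤ τ₀) {T : ℕ} (hT : 1 ≤ T) :
    ∑ t ∈ Finset.Icc 1 T, (t : ℝ) ^ θ₁ / α₀ * S.triggerError t ≤
      n * (τ₀ / α₀ * ∑ t ∈ Finset.Icc 2 T, (t : ℝ) ^ (-(θ₃ - θ₁))) := by
  rw [hS.sum_Icc_one_mul_triggerError hT, Finset.mul_sum, Finset.mul_sum]
  refine Finset.sum_le_sum fun t ht => ?_
  have ht2 := (Finset.mem_Icc.1 ht).1
  have ht0 : (0 : ℝ) < t := by exact_mod_cast (show 0 < t by omega)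
  have hτ : (powerParams α₀ τ₀ θ₁ θ₂ θ₃).τ t = τ₀ / (t : ℝ) ^ θ₃ := rfl
  have hτ0 : 0 ≤ (powerParams α₀ τ₀ θ₁ θ₂ θ₃).τ t := by rw [hτ]; positivity
  have h := (hS.triggerError_le hP ht2 hτ0).trans
    (mul_le_mul_of_nonneg_left (min_le_right _ _) (Nat.cast_nonneg n))
  rw [hτ] at h
  refine (mul_le_mul_of_nonneg_left h (by positivity)).trans (le_of_eq ?_)
  rw [neg_sub, Real.rpow_sub ht0]
  ring

theorem exists_netRegret_bound (n : ℕ) (hn : 1 ≤ n) (m : Fin n → ℕ) {R F₁ F₂ w : ℝ} (B : ℕ)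
    (hR : 0 ≤ R) (hF₁ : 0 ≤ F₁) (hF₂ : 0 ≤ F₂) (hw : 0 < w)
    {θ₁ θ₂ : ℝ} (θ₃ : ℝ) (hθ₁ : 0 ≤ θ₁) (hθ₁' : θ₁ < 1) (hθ₂ : 0 < θ₂) (hθ₂' : θ₂ < 1) :
    ∃ C : ℝ, 0 < C ∧ ∀ (p : ℕ) (P : Problem n p m) (N : Network n) (S : Trajectory n p m)
      (α₀ τ₀ : ℝ), 0 < α₀ → 0 < τ₀ → P.Regular R F₁ F₂ → N.Regular w B →
      S.IsGenerated P N (powerParams α₀ τ₀ θ₁ θ₂ θ₃) F₂ →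
      ∀ (T : ℕ), 1 ≤ T → ∀ y : ℕ → Vec p, P.Feasible T y →
      P.netRegret S.x T y ≤ C * (α₀ * (T : ℝ) ^ (1 - θ₁) + (T : ℝ) ^ θ₂
        + τ₀ / α₀ * ∑ t ∈ Finset.Icc 2 T, (t : ℝ) ^ (-(θ₃ - θ₁))
        + (T : ℝ) ^ θ₁ * (1 + pathLength y T) / α₀) := by
  have hn' : (1 : ℝ) ≤ n := by exact_mod_cast hn
  have h1θ₁ : 0 < 1 - θ₁ := by linarith
  -- This `κ` covers the cost of evaluating all losses at every agent; the bound is later used with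
  -- `s = 0`.
  obtain ⟨C, hC, hbound⟩ := exists_combined_bound n hn m B hR hF₁ hF₂ hw θ₃ hθ₁ hθ₁' hθ₂ hθ₂'
    (κ := 2 * n * F₂) (by positivity)
  set k := 2 * R * n / (1 - θ₁) with hk
  have hk0 : 0 ≤ k := by positivity
  refine ⟨C * (2 + k + 2 * n), by positivity, ?_⟩
  intro p P N S α₀ τ₀ hα₀ hτ₀ hP hN hS T hT y hy
  have hT1 : (1 : ℝ) ≤ T := by exact_mod_cast hT
  have h := hbound p P N S α₀ τ₀ hα₀ hP hN hS T hT y hy 0 le_rfl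
  have hreg := hS.mul_netRegret_le hP hF₂ hn T y
  have hlast := sum_rpow_div_mul_triggerError_le hS hP hα₀ hτ₀.le hT
  set D := ∑ t ∈ Finset.Icc 2 T, (t : ℝ) ^ (-(θ₃ - θ₁)) with hD
  have hD0 : 0 ≤ τ₀ / α₀ * D :=
    mul_nonneg (by positivity) (Finset.sum_nonneg fun t _ => by positivity)
  have hE : ∑ t ∈ Finset.Icc 1 T, S.triggerError t ≤
      k * (α₀ * (T : ℝ) ^ (1 - θ₁)) + n * (τ₀ / α₀ * D) := by
    have h0 := hS.sum_Icc_one_mul_triggerError hT fun _ => 1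
    simp only [one_mul] at h0
    rw [h0]
    have h1 : ∀ t ∈ Finset.Icc 2 T, S.triggerError t ≤
        n * (2 * R * (α₀ * (t : ℝ) ^ (-θ₁)) + τ₀ / α₀ * (t : ℝ) ^ (-(θ₃ - θ₁))) := fun t ht => by
      have ht2 := (Finset.mem_Icc.1 ht).1
      have ht0 : (0 : ℝ) < t := by exact_mod_cast (show 0 < t by omega)
      have hτ : (powerParams α₀ τ₀ θ₁ θ₂ θ₃).τ t = τ₀ / (t : ℝ) ^ θ₃ := rfl
      have hτ0 : 0 ≤ (powerParams α₀ τ₀ θ₁ θ₂ θ₃).τ t := by rw [hτ]; positivity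
      have hp := Real.rpow_pos_of_pos ht0 θ₁
      have h2 := min_le_mul_add_div (D := 2 * R) (α := α₀ * (t : ℝ) ^ (-θ₁)) (by positivity) hτ0
        (by positivity)
      have h3 : τ₀ / (t : ℝ) ^ θ₃ / (α₀ * (t : ℝ) ^ (-θ₁)) =
          τ₀ / α₀ * (t : ℝ) ^ (-(θ₃ - θ₁)) := by
        rw [neg_sub, Real.rpow_sub ht0, Real.rpow_neg ht0.le]
        field_simp
      rw [hτ, h3] at h2
      exact (hS.triggerError_le hP ht2 hτ0).trans
        (mul_le_mul_of_nonneg_left h2 (Nat.cast_nonneg n))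
    refine (Finset.sum_le_sum h1).trans ?_
    rw [← Finset.mul_sum, Finset.sum_add_distrib, ← Finset.mul_sum, ← Finset.mul_sum,
      ← Finset.mul_sum, mul_add]
    refine add_le_add_left ?_ _
    have h4 := mul_le_mul_of_nonneg_left (sum_Icc_two_rpow_neg_le hθ₁ hθ₁' T)
      (show 0 ≤ n * (2 * R * α₀) by positivity)
    rw [hk]
    refine le_trans (le_of_eq ?_) (h4.trans (le_of_eq ?_)) <;> ring
  have hPL : 0 ≤ pathLength y T := Finset.sum_nonneg fun _ _ => norm_nonneg _
  have hV0 : 0 ≤ ∑ t ∈ Finset.Icc 1 T, S.disagreement t :=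
    Finset.sum_nonneg fun _ _ => S.disagreement_nonneg _
  have hE0 : 0 ≤ ∑ t ∈ Finset.Icc 1 T, S.triggerError t :=
    Finset.sum_nonneg fun _ _ => S.triggerError_nonneg _
  have hX₁ : 0 ≤ α₀ * (T : ℝ) ^ (1 - θ₁) := by positivity
  have hX₂ : 1 ≤ (T : ℝ) ^ θ₂ := Real.one_le_rpow hT1 hθ₂.le
  have hX₃ : 0 ≤ (T : ℝ) ^ θ₁ * (1 + pathLength y T) / α₀ := by positivity
  generalize α₀ * (T : ℝ) ^ (1 - θ₁) = X₁ at *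
  generalize (T : ℝ) ^ θ₂ = X₂ at *
  generalize (T : ℝ) ^ θ₁ * (1 + pathLength y T) / α₀ = X₃ at *
  generalize τ₀ / α₀ * D = X₄ at *
  generalize ∑ t ∈ Finset.Icc 1 T, S.triggerError t = SE at *
  generalize ∑ t ∈ Finset.Icc 1 T, S.disagreement t = SV at *
  have h1 : F₂ * (n * SV + 2 * SE) ≤ 2 * n * F₂ * (1 + 0) * (SE + SV) := by
    have e1 : 0 ≤ F₂ * (n * SV) := by positivity
    have e2 : 0 ≤ F₂ * ((n - 1) * SE) := mul_nonneg hF₂ (mul_nonneg (by linarith) hE0)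
    linarith
  have hZ : 0 ≤ X₁ + X₂ + X₄ + X₃ := by positivity
  have h2 : n * P.netRegret S.x T y ≤ C * (2 + k + 2 * n) * (X₁ + X₂ + X₄ + X₃) := by
    rw [mul_assoc C]
    refine hreg.trans (le_trans (by linarith) (h.trans (mul_le_mul_of_nonneg_left ?_ hC.le)))
    have e1 : 0 ≤ k * (X₂ + X₄ + X₃) := by positivity
    have e2 : 0 ≤ n * (X₁ + X₂ + X₃) := by positivity
    linarith
  -- Dropping the factor `n ≥ 1` needs a nonnegative bound, since the regret itself may be negative.
  have h3 : 0 ≤ C * (2 + k + 2 * n) * (X₁ + X₂ + X₄ + X₃) := by positivity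
  by_contra! hcon
  nlinarith

set_option maxHeartbeats 1000000 in
theorem exists_netCCV_bound (n : ℕ) (hn : 1 ≤ n) (m : Fin n → ℕ) {R F₁ F₂ w : ℝ} (B : ℕ)
    (hR : 0 ≤ R) (hF₁ : 0 ≤ F₁) (hF₂ : 0 ≤ F₂) (hw : 0 < w)
    {θ₁ θ₂ θ₃ : ℝ} (hθ₁ : 0 ≤ θ₁) (hθ₁' : θ₁ < 1) (hθ₂ : 0 < θ₂) (hθ₂' : θ₂ < 1)
    (hθ₁₃ : θ₁ ≤ θ₃) {a b : ℝ} (ha : 0 < a) (hb : 0 < b) :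
    ∃ C : ℝ, 0 < C ∧ ∀ (p : ℕ) (P : Problem n p m) (N : Network n) (S : Trajectory n p m)
      (α₀ τ₀ : ℝ), a ≤ α₀ → 0 < τ₀ → τ₀ ≤ b → P.Regular R F₁ F₂ → N.Regular w B →
      S.IsGenerated P N (powerParams α₀ τ₀ θ₁ θ₂ θ₃) F₂ →
      ∀ (T : ℕ), 1 ≤ T → (∃ v : Vec p, P.Feasible T fun _ => v) →
      P.netCCV S.x T ≤ C * (√α₀ * (T : ℝ) ^ (1 - θ₁ / 2) + (T : ℝ) ^ (1 - θ₂ / 2)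
        + √(T * (τ₀ * ∑ t ∈ Finset.Icc 2 T, (t : ℝ) ^ (-θ₃)))) := by
  have hn' : (1 : ℝ) ≤ n := by exact_mod_cast hn
  have hM0 : 0 ≤ ∑ j, (m j : ℝ) := Finset.sum_nonneg fun _ _ => Nat.cast_nonneg _
  obtain ⟨C, hC, hbound⟩ := exists_combined_bound n hn m B hR hF₁ hF₂ hw θ₃ hθ₁ hθ₁' hθ₂ hθ₂'
    (κ := 2 * F₂ * ∑ j, (m j : ℝ)) (by positivity)
  set k := 7 + 4 * R * n + n + 1 / a + n * (b / a) with hk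
  have hk0 : 0 < k := by positivity
  have hkn : 0 ≤ 2 * (C * k + n * F₁) := by positivity
  refine ⟨2 * (C * k + n * F₁), by positivity, ?_⟩
  rintro p P N S α₀ τ₀ haα hτ₀ hτb hP hN hS T hT ⟨v, hv⟩
  have hα₀ : 0 < α₀ := ha.trans_le haα
  have hT1 : (1 : ℝ) ≤ T := by exact_mod_cast hT
  have hT0 : (0 : ℝ) < T := by linarith
  set Θ := τ₀ * ∑ t ∈ Finset.Icc 2 T, (t : ℝ) ^ (-θ₃) with hΘ
  have hΘ0 : 0 ≤ Θ := mul_nonneg hτ₀.le (Finset.sum_nonneg fun t _ => by positivity)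
  -- If `α₀ ≥ T ^ θ₁`, the first term of the claim already exceeds `T` and the trivial bound
  -- suffices. Otherwise `α₀ * T ^ (1 - θ₁) ≤ T`, so the part of the step-size term not multiplied
  -- by `s ^ 2` is harmless.
  rcases le_total ((T : ℝ) ^ θ₁) α₀ with hlarge | hsmall
  · refine (hS.netCCV_le_trivial hP hF₁ hn T).trans ?_
    have h1 : (T : ℝ) ≤ √α₀ * (T : ℝ) ^ (1 - θ₁ / 2) := by
      calc (T : ℝ) = √((T : ℝ) ^ θ₁) * (T : ℝ) ^ (1 - θ₁ / 2) := by
            rw [Real.sqrt_eq_rpow, ← Real.rpow_mul hT0.le, ← Real.rpow_add hT0]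
            ring_nf
            rw [Real.rpow_one]
        _ ≤ _ := by gcongr
    have h2 : 0 ≤ (T : ℝ) ^ (1 - θ₂ / 2) + √(T * Θ) := by positivity
    calc n * F₁ * T ≤ 2 * (C * k + n * F₁) * T := by
          have h3 : 0 ≤ C * k := by positivity
          have h4 : 0 ≤ n * F₁ := by positivity
          exact mul_le_mul_of_nonneg_right (by linarith) hT0.le
      _ ≤ _ := mul_le_mul_of_nonneg_left (by linarith) hkn
  have hA₁ : 1 ≤ (T : ℝ) ^ (1 - θ₂) := Real.one_le_rpow hT1 (by linarith)
  have hα₁0 : 0 ≤ α₀ * (T : ℝ) ^ (1 - θ₁) := by positivity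
  have hα₁T : α₀ * (T : ℝ) ^ (1 - θ₁) ≤ T := by
    calc α₀ * (T : ℝ) ^ (1 - θ₁) ≤ (T : ℝ) ^ θ₁ * (T : ℝ) ^ (1 - θ₁) := by gcongr
      _ = T := by rw [← Real.rpow_add hT0]; simp
  set A := (T : ℝ) ^ (1 - θ₂) + α₀ * (T : ℝ) ^ (1 - θ₁) + Θ with hA
  -- Everything not multiplied by `s ^ 2` may be as large as `T`. That includes the lower bound on
  -- the loss differences and, through `a ≤ α₀` and `τ₀ ≤ b`, the path and weighted trigger terms.
  have hkey : ∀ s, 0 ≤ s → s * P.netCCV S.x T ≤ (C * k + n * F₁) * (T + s ^ 2 * A) := by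
    intro s hs
    have h := hbound p P N S α₀ τ₀ hα₀ hP hN hS T hT _ hv s hs
    have hlow := hS.neg_mul_le_sum_loss hP hv
    have hccv := mul_le_mul_of_nonneg_left (hS.netCCV_le hP hF₂ hn T) hs
    have hlast := sum_rpow_div_mul_triggerError_le hS hP hα₀ hτ₀.le hT
    have hpl : pathLength (fun _ => v) T = 0 := by simp [pathLength]
    have hτ : ∀ t, (powerParams α₀ τ₀ θ₁ θ₂ θ₃).τ t = τ₀ / (t : ℝ) ^ θ₃ := fun _ => rfl
    have hτ0 : ∀ t, 0 ≤ (powerParams α₀ τ₀ θ₁ θ₂ θ₃).τ t := fun t => by rw [hτ]; positivity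
    have hcard : ((Finset.Icc 2 T).card : ℝ) ≤ T := by
      rw [Nat.card_Icc]; exact_mod_cast (by omega)
    have hE1 : ∑ t ∈ Finset.Icc 1 T, S.triggerError t ≤ 2 * R * n * T := by
      have h0 := hS.sum_Icc_one_mul_triggerError hT fun _ => 1
      simp only [one_mul] at h0
      rw [h0]
      have h1 : ∀ t ∈ Finset.Icc 2 T, S.triggerError t ≤ 2 * R * n := fun t ht =>
        (hS.triggerError_le hP (Finset.mem_Icc.1 ht).1 (hτ0 t)).trans
          ((mul_le_mul_of_nonneg_left (min_le_left _ _) (Nat.cast_nonneg n)).trans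
            (le_of_eq (mul_comm _ _)))
      refine (Finset.sum_le_card_nsmul _ _ _ h1).trans ?_
      rw [nsmul_eq_mul, mul_comm]
      exact mul_le_mul_of_nonneg_left hcard (by positivity)
    have hE2 : s * ∑ t ∈ Finset.Icc 1 T, S.triggerError t ≤ n * (s ^ 2 * Θ) + 2 * R * n * T := by
      have h0 := hS.sum_Icc_one_mul_triggerError hT fun _ => s
      rw [Finset.mul_sum, h0]
      have h1 : ∀ t ∈ Finset.Icc 2 T, s * S.triggerError t ≤
          n * (s ^ 2 * (τ₀ * (t : ℝ) ^ (-θ₃))) + 2 * R * n := fun t ht => by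
        have h2 := mul_le_mul_of_nonneg_left
          (hS.triggerError_le hP (Finset.mem_Icc.1 ht).1 (hτ0 t)) hs
        have h3 := mul_le_mul_of_nonneg_left
          (mul_min_le (D := 2 * R) (by positivity) (hτ0 t) hs) (Nat.cast_nonneg (α := ℝ) n)
        have h4 : (powerParams α₀ τ₀ θ₁ θ₂ θ₃).τ t = τ₀ * (t : ℝ) ^ (-θ₃) := by
          rw [hτ, Real.rpow_neg (Nat.cast_nonneg _)]; rfl
        rw [h4] at h2 h3
        linarith
      refine (Finset.sum_le_sum h1).trans ?_
      rw [Finset.sum_add_distrib, Finset.sum_const, nsmul_eq_mul, ← Finset.mul_sum,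
        ← Finset.mul_sum, ← Finset.mul_sum]
      have h5 := mul_le_mul_of_nonneg_right hcard (show 0 ≤ 2 * R * n by positivity)
      linarith
    have hE3 : τ₀ / α₀ * ∑ t ∈ Finset.Icc 2 T, (t : ℝ) ^ (-(θ₃ - θ₁)) ≤ b / a * T := by
      -- The crude bound by one is enough and is the place where `θ₁ ≤ θ₃` enters.
      have h1 : ∀ t ∈ Finset.Icc 2 T, (t : ℝ) ^ (-(θ₃ - θ₁)) ≤ 1 := fun t ht =>
        Real.rpow_le_one_of_one_le_of_nonpos
          (by exact_mod_cast (show 1 ≤ t from by have := (Finset.mem_Icc.1 ht).1; omega))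
          (by linarith)
      have h2 := (Finset.sum_le_card_nsmul _ _ _ h1).trans
        (le_of_eq_of_le (by simp [nsmul_eq_mul]) hcard)
      exact mul_le_mul (div_le_div₀ hb.le hτb ha haα) h2
        (Finset.sum_nonneg fun t _ => by positivity) (by positivity)
    have hX₄ : (T : ℝ) ^ θ₂ ≤ T := by
      simpa using Real.rpow_le_rpow_of_exponent_le hT1 hθ₂'.le
    have hX₅ : (T : ℝ) ^ θ₁ * (1 + pathLength (fun _ => v) T) / α₀ ≤ 1 / a * T := by
      rw [hpl, add_zero, mul_one, one_div_mul_eq_div]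
      refine div_le_div₀ hT0.le ?_ ha haα
      simpa using Real.rpow_le_rpow_of_exponent_le hT1 hθ₁'.le
    have hEn := mul_le_mul_of_nonneg_left hE3 (Nat.cast_nonneg (α := ℝ) n)
    set SE := ∑ t ∈ Finset.Icc 1 T, S.triggerError t
    set SV := ∑ t ∈ Finset.Icc 1 T, S.disagreement t
    have hE0 : 0 ≤ SE := Finset.sum_nonneg fun _ _ => S.triggerError_nonneg _
    have hV0 : 0 ≤ SV := Finset.sum_nonneg fun _ _ => S.disagreement_nonneg _
    have hκ : 0 ≤ 2 * F₂ * (∑ j, (m j : ℝ)) * (SE + SV) := by positivity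
    have hs2 : 0 ≤ s ^ 2 := sq_nonneg s
    have hs1 : s ≤ 1 + s ^ 2 := by linarith [two_mul_le_add_sq s 1]
    have hs3 : (1 + s) ^ 2 ≤ 2 + 2 * s ^ 2 := by linarith [two_mul_le_add_sq s 1]
    have hY₁ : (1 + s) ^ 2 * (α₀ * (T : ℝ) ^ (1 - θ₁)) ≤
        2 * T + 2 * (s ^ 2 * (α₀ * (T : ℝ) ^ (1 - θ₁))) := by
      linarith [mul_le_mul_of_nonneg_right hs3 hα₁0]
    have hY₃ : s ^ 2 ≤ s ^ 2 * (T : ℝ) ^ (1 - θ₂) := le_mul_of_one_le_right hs2 hA₁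
    have hsA : s ^ 2 * A = s ^ 2 * (T : ℝ) ^ (1 - θ₂) + s ^ 2 * (α₀ * (T : ℝ) ^ (1 - θ₁))
      + s ^ 2 * Θ := by rw [hA]; ring
    have hZ₂ : 0 ≤ s ^ 2 * (α₀ * (T : ℝ) ^ (1 - θ₁)) := by positivity
    have hZ₃ : 0 ≤ s ^ 2 * Θ := by positivity
    have hbr : (1 + s) ^ 2 * (α₀ * (T : ℝ) ^ (1 - θ₁)) + (1 + s) * (1 + SE)
        + s ^ 2 * (T : ℝ) ^ (1 - θ₂) + (T : ℝ) ^ θ₂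
        + (T : ℝ) ^ θ₁ * (1 + pathLength (fun _ => v) T) / α₀
        + ∑ t ∈ Finset.Icc 1 T, (t : ℝ) ^ θ₁ / α₀ * S.triggerError t ≤ k * (T + s ^ 2 * A) := by
      have hW : 0 ≤ s ^ 2 * A := by rw [hsA]; positivity
      have hΘA : s ^ 2 * Θ ≤ s ^ 2 * A := by
        rw [hsA]; exact le_add_of_nonneg_left (by positivity)
      have hnW : n * (s ^ 2 * Θ) ≤ n * (s ^ 2 * A) :=
        mul_le_mul_of_nonneg_left hΘA (Nat.cast_nonneg n)
      clear_value A Θ SE SV k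
      clear h hccv hlow hbound
      have e : k * (T + s ^ 2 * A) = 7 * T + 7 * (s ^ 2 * A) + 4 * R * n * T + n * (s ^ 2 * A)
          + n * T + 1 / a * T + n * (b / a * T)
          + (4 * R * n + 1 / a + n * (b / a)) * (s ^ 2 * A) := by rw [hk]; ring
      have e1 : 0 ≤ (4 * R * n + 1 / a + n * (b / a)) * (s ^ 2 * A) := by positivity
      have e2 : 0 ≤ n * (T : ℝ) := by positivity
      rw [e]
      linarith
    have h2 := h.trans (mul_le_mul_of_nonneg_left hbr hC.le)
    have hsA0 : 0 ≤ s ^ 2 * A := by rw [hsA]; positivity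
    have h3 : n * F₁ * T ≤ n * F₁ * (T + s ^ 2 * A) :=
      mul_le_mul_of_nonneg_left (le_add_of_nonneg_right hsA0) (by positivity)
    linarith
  have hA0 : 0 < A := by rw [hA]; linarith
  have hX := le_two_mul_sqrt_of_forall_mul_le hT0 hA0 hkey
  refine hX.trans (mul_le_mul_of_nonneg_left ?_ hkn)
  have h1 : √(T * A) ≤ √(T * (T : ℝ) ^ (1 - θ₂)) + √(α₀ * (T * (T : ℝ) ^ (1 - θ₁))) + √(T * Θ) := by
    have e : T * A = T * (T : ℝ) ^ (1 - θ₂) + α₀ * (T * (T : ℝ) ^ (1 - θ₁)) + T * Θ := by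
      rw [hA]; ring
    rw [e]
    refine (sqrt_add_le (by positivity) (by positivity)).trans (add_le_add_left ?_ _)
    exact sqrt_add_le (by positivity) (by positivity)
  rw [Real.sqrt_mul hα₀.le, sqrt_mul_rpow_one_sub hT0, sqrt_mul_rpow_one_sub hT0] at h1
  linarith

end EventTriggered

end

/-! ### The three regimes of the threshold exponent. -/

theorem theorem2 (n : ℕ) (hn : 1 ≤ n) (m : Fin n → ℕ) (R F₁ F₂ w : ℝ) (B : ℕ)
    (hR : 0 < R) (hF₁ : 0 < F₁) (hF₂ : 0 < F₂) (hw₀ : 0 < w) (hw₁ : w < 1) (hB : 0 < B)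
    (θ₁ θ₂ θ₃ : ℝ) (hθ₁ : 0 < θ₁) (hθ₁' : θ₁ < 1) (hθ₂ : 0 < θ₂) (hθ₂' : θ₂ < 1)
    (hθ₃ : 0 < θ₃) :
    -- dynamic network regret: one constant for all `α₀`, `τ₀`
    (∃ C : ℝ, 0 < C ∧
      ∀ (p : ℕ) (P : EventTriggered.Problem n p m) (N : EventTriggered.Network n)
        (S : EventTriggered.Trajectory n p m) (α₀ τ₀ : ℝ), 0 < α₀ → 0 < τ₀ →
      P.Regular R F₁ F₂ → N.Regular w B →
      S.IsGenerated P N (EventTriggered.powerParams α₀ τ₀ θ₁ θ₂ θ₃) F₂ →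
      ∀ (T : ℕ), 1 ≤ T → ∀ y : ℕ → EventTriggered.Vec p, P.Feasible T y →
        (θ₁ < θ₃ → θ₃ < 1 + θ₁ →
          P.netRegret S.x T y ≤ C * (α₀ * (T : ℝ) ^ (1 - θ₁) + (T : ℝ) ^ θ₂
            + τ₀ / α₀ * (T : ℝ) ^ (1 + θ₁ - θ₃)
            + (T : ℝ) ^ θ₁ * (1 + EventTriggered.pathLength y T) / α₀)) ∧
        (θ₃ = 1 + θ₁ →
          P.netRegret S.x T y ≤ C * (α₀ * (T : ℝ) ^ (1 - θ₁) + (T : ℝ) ^ θ₂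
            + τ₀ / α₀ * Real.log T
            + (T : ℝ) ^ θ₁ * (1 + EventTriggered.pathLength y T) / α₀)) ∧
        (1 + θ₁ < θ₃ →
          P.netRegret S.x T y ≤ C * (α₀ * (T : ℝ) ^ (1 - θ₁) + (T : ℝ) ^ θ₂
            + τ₀ / α₀
            + (T : ℝ) ^ θ₁ * (1 + EventTriggered.pathLength y T) / α₀))) ∧
    -- network cumulative constraint violation: one constant for all `α₀ ≥ a`, `τ₀ ≤ b`
    (∀ a b : ℝ, 0 < a → 0 < b → ∃ C : ℝ, 0 < C ∧
      ∀ (p : ℕ) (P : EventTriggered.Problem n p m) (N : EventTriggered.Network n)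
        (S : EventTriggered.Trajectory n p m) (α₀ τ₀ : ℝ), a ≤ α₀ → 0 < τ₀ → τ₀ ≤ b →
      P.Regular R F₁ F₂ → N.Regular w B →
      S.IsGenerated P N (EventTriggered.powerParams α₀ τ₀ θ₁ θ₂ θ₃) F₂ →
      ∀ (T : ℕ), 1 ≤ T → (∃ v : EventTriggered.Vec p, P.Feasible T (fun _ => v)) →
        (θ₁ < θ₃ → θ₃ < 1 →
          P.netCCV S.x T ≤ C * (√α₀ * (T : ℝ) ^ (1 - θ₁ / 2) + (T : ℝ) ^ (1 - θ₂ / 2)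
            + √τ₀ * (T : ℝ) ^ (1 - θ₃ / 2))) ∧
        (θ₃ = 1 →
          P.netCCV S.x T ≤ C * (√α₀ * (T : ℝ) ^ (1 - θ₁ / 2) + (T : ℝ) ^ (1 - θ₂ / 2)
            + √(τ₀ * T * Real.log T))) ∧
        (1 < θ₃ →
          P.netCCV S.x T ≤ C * (√α₀ * (T : ℝ) ^ (1 - θ₁ / 2) + (T : ℝ) ^ (1 - θ₂ / 2)
            + √τ₀ * (T : ℝ) ^ (1 / 2 : ℝ)))) := by
  refine ⟨?_, fun a b ha hb => ?_⟩
  · obtain ⟨C, hC, hbound⟩ := EventTriggered.exists_netRegret_bound n hn m B hR.le hF₁.le hF₂.le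
      hw₀ θ₃ hθ₁.le hθ₁' hθ₂ hθ₂'
    obtain ⟨K, hK, hsum⟩ := EventTriggered.exists_sum_Icc_two_rpow_neg_le (θ₃ - θ₁)
    refine ⟨C * (1 + K), by positivity, ?_⟩
    intro p P N S α₀ τ₀ hα₀ hτ₀ hP hN hS T hT y hy
    have h := hbound p P N S α₀ τ₀ hα₀ hτ₀ hP hN hS T hT y hy
    obtain ⟨hsum₁, hsum₂, hsum₃⟩ := hsum T hT
    have hPL : 0 ≤ EventTriggered.pathLength y T := Finset.sum_nonneg fun _ _ => norm_nonneg _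
    have hT1 : (1 : ℝ) ≤ T := by exact_mod_cast hT
    have key : ∀ D : ℝ, 0 ≤ D → ∑ t ∈ Finset.Icc 2 T, (t : ℝ) ^ (-(θ₃ - θ₁)) ≤ K * D →
        P.netRegret S.x T y ≤ C * (1 + K) * (α₀ * (T : ℝ) ^ (1 - θ₁) + (T : ℝ) ^ θ₂
          + τ₀ / α₀ * D + (T : ℝ) ^ θ₁ * (1 + EventTriggered.pathLength y T) / α₀) := by
      intro D hD hle
      refine h.trans ?_
      rw [mul_assoc C]
      refine mul_le_mul_of_nonneg_left ?_ hC.le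
      have h1 := mul_le_mul_of_nonneg_left hle (show 0 ≤ τ₀ / α₀ by positivity)
      have h2 : 0 ≤ K * (α₀ * (T : ℝ) ^ (1 - θ₁) + (T : ℝ) ^ θ₂
        + (T : ℝ) ^ θ₁ * (1 + EventTriggered.pathLength y T) / α₀) := by positivity
      have h3 : 0 ≤ τ₀ / α₀ * D := by positivity
      linarith
    refine ⟨fun h1 h2 => ?_, fun h1 => ?_, fun h1 => ?_⟩
    · refine key _ (by positivity) ?_
      rw [show 1 + θ₁ - θ₃ = 1 - (θ₃ - θ₁) by ring]
      exact hsum₁ (by linarith) (by linarith)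
    · exact key _ (Real.log_nonneg hT1) (hsum₂ (by linarith))
    · have h2 := key 1 zero_le_one (by rw [mul_one]; exact hsum₃ (by linarith))
      rwa [mul_one] at h2
  -- If `θ₃ < θ₁ < 1`, none of the three regimes occurs, so any positive constant works.
  · rcases le_or_gt θ₁ θ₃ with h₁₃ | h₁₃
    swap
    · exact ⟨1, one_pos, fun p P N S α₀ τ₀ _ _ _ _ _ _ T _ _ => ⟨fun h => by linarith,
        fun h => by linarith, fun h => by linarith⟩⟩
    obtain ⟨C, hC, hbound⟩ := EventTriggered.exists_netCCV_bound n hn m B hR.le hF₁.le hF₂.le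
      hw₀ hθ₁.le hθ₁' hθ₂ hθ₂' h₁₃ ha hb
    obtain ⟨K, hK, hsum⟩ := EventTriggered.exists_sum_Icc_two_rpow_neg_le θ₃
    refine ⟨C * (1 + √K), by positivity, ?_⟩
    intro p P N S α₀ τ₀ hα₀ hτ₀ hτb hP hN hS T hT hv
    have h := hbound p P N S α₀ τ₀ hα₀ hτ₀ hτb hP hN hS T hT hv
    obtain ⟨hsum₁, hsum₂, hsum₃⟩ := hsum T hT
    have hT1 : (1 : ℝ) ≤ T := by exact_mod_cast hT
    have hT0 : (0 : ℝ) < T := by linarith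
    have key : ∀ D : ℝ, ∑ t ∈ Finset.Icc 2 T, (t : ℝ) ^ (-θ₃) ≤ K * D →
        P.netCCV S.x T ≤ C * (1 + √K) * (√α₀ * (T : ℝ) ^ (1 - θ₁ / 2) + (T : ℝ) ^ (1 - θ₂ / 2)
          + √(τ₀ * T * D)) := by
      intro D hle
      refine h.trans ?_
      rw [mul_assoc C]
      refine mul_le_mul_of_nonneg_left ?_ hC.le
      have h1 : √(T * (τ₀ * ∑ t ∈ Finset.Icc 2 T, (t : ℝ) ^ (-θ₃))) ≤ √K * √(τ₀ * T * D) := by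
        rw [← Real.sqrt_mul hK]
        refine Real.sqrt_le_sqrt ?_
        have := mul_le_mul_of_nonneg_left hle (show 0 ≤ T * τ₀ by positivity)
        linarith
      have h2 : 0 ≤ √K * (√α₀ * (T : ℝ) ^ (1 - θ₁ / 2) + (T : ℝ) ^ (1 - θ₂ / 2)) := by positivity
      have h3 : 0 ≤ √(τ₀ * T * D) := Real.sqrt_nonneg _
      linarith
    refine ⟨fun h1 h2 => ?_, fun h1 => ?_, fun h1 => ?_⟩
    · have h3 := key _ (hsum₁ hθ₃ h2)
      rwa [mul_assoc τ₀, Real.sqrt_mul hτ₀.le, EventTriggered.sqrt_mul_rpow_one_sub hT0] at h3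
    · exact key _ (hsum₂ h1)
    · have h3 := key 1 (by rw [mul_one]; exact hsum₃ h1)
      rwa [mul_one, Real.sqrt_mul hτ₀.le, Real.sqrt_eq_rpow (T : ℝ)] at h3
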